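/- Let $d\ge 1$ and let $\Omega\subset\mathbb R^d$ be a bounded open set with boundary $\partial\Omega=\overline\Omega\setminus\Omega$. Let $H^1(\Omega)$ be the Sobolev space of all real $u\in L^2(\Omega)$ with weak gradient $\nabla u\in L^2(\Omega)^d$, with its usual inner product $\int_\Omega (uv+\nabla u\cdot\nabla v)\,dx$, and write $\partial_\theta u=\theta\cdot\nabla u$ for $\theta$ in the unit sphere $\mathbb S^{d-1}$. For $\theta\in\mathbb S^{d-1}$ and $x\in\Omega$ let $\delta_\theta(x)=\sup\{s\ge 0: x+t\theta\in\Omega \text{ for all } t\in[0,s[\}$ and $\Phi_\theta(x)=x+\delta_\theta(x)\theta\in\partial\Omega$. Put $\partial_\theta\Omega=\Phi_\theta(\Omega)$, and for $z=\Phi_\theta(x)\in\partial_\theta\Omega$ put $\Phi_{-\theta}(z)=\Phi_{-\theta}(x)$, the other end of the chord of $\Omega$ parallel to $\theta$ that ends at $z$, and $\ell_{-\theta}(z)=|\Phi_{-\theta}(z)-z|$. Let $\mu_\theta$ be the finite Borel measure on $\partial\Omega$ given by $\mu_\theta(A)=\lambda^d(\{x\in\Omega:\Phi_\theta(x)\in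 A\})$; it is carried by $\partial_\theta\Omega$. Let $H_\theta=\theta^\perp$, let $\mathcal P_\theta$ be the orthogonal projection onto $H_\theta$, and for $y\in H_\theta$ let $\omega_\theta(y)=\{s\in\mathbb R: s\theta+y\in\Omega\}$. A function $g:\partial\Omega\to\mathbb R$ is a directional trace of $u\in H^1(\Omega)$ in the direction $\theta$ if there are a representative of $u$ and a set $A\subset\mathcal P_\theta(\Omega)$ such that $\mathcal P_\theta(\Omega)\setminus A$ is $\lambda^{d-1}$-negligible and, for every $y\in A$, the function $s\mapsto u(s\theta+y)$ belongs to $H^1(\omega_\theta(y))$ and, for every connected component $]\alpha,\beta[$ of $\omega_\theta(y)$, its representative that is continuous on $]\alpha,\beta]$ takes the value $g(\beta\theta+y)$ at $\beta$. Write $\gamma_\theta u$ for the set of all directional traces of $u$ in the direction $\theta$ (they are all equal $\mu_\theta$-a.e.). Let $\mathcal L^2(\partial\Omega,(\mu_\theta)_\theta)$ be the set of all $f:\partial\Omega\to\mathbb R$ that for every $\theta\in\mathbb S^{d-1}$ are $\mu_\theta$-a.e. equal to an element of $\mathcal L^2(\partial\Omega,\mu_\theta)$, with $\sup_{\theta}\int_{\partial\Omega}|f|^2\,d\mu_\theta<\infty$.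 Let $L^2(\partial\Omega,(\mu_\theta)_\theta)$ be the quotient by the relation "equal $\mu_\theta$-a.e. for every $\theta$", with the norm $\|f\|=\sup_\theta\big(\int_{\partial\Omega}|f|^2\,d\mu_\theta\big)^{1/2}$. Let $H^1_{\rm tr}(\Omega)$ be the set of all $u\in H^1(\Omega)$ for which there is $g\in L^2(\partial\Omega,(\mu_\theta)_\theta)$ with $g=\gamma_\theta u$ $\mu_\theta$-a.e. for every $\theta\in\mathbb S^{d-1}$, and then put ${\rm tr}(u)=g$. Then $H^1_{\rm tr}(\Omega)$ is a closed linear subspace of $H^1(\Omega)$, hence a Hilbert space. The operator ${\rm tr}:H^1_{\rm tr}(\Omega)\to L^2(\partial\Omega,(\mu_\theta)_{\theta\in\mathbb S^{d-1}})$ is well defined, linear and continuous. Moreover, for all $u,v\in H^1_{\rm tr}(\Omega)$ and all $\theta\in\mathbb S^{d-1}$, the integrand on the right-hand side below is $\mu_\theta$-integrable and $$\int_\Omega\big(u\,\partial_\theta v+v\,\partial_\theta u\big)\,dx=\int_{\partial\Omega}\frac{{\rm tr}(u)(z)\,{\rm tr}(v)(z)-{\rm tr}(u)(\Phi_{-\theta}(z))\,{\rm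 tr}(v)(\Phi_{-\theta}(z))}{\ell_{-\theta}(z)}\,d\mu_\theta(z).$$ -/

import Mathlib

open MeasureTheory Set Filter Topology
open scoped ENNReal ContDiff

noncomputable section

namespace OmniTrace

/-! ### Weak directional derivatives -/

/-- `φ ∈ C_c^∞(Ω)`. -/
def IsTestFunction {F : Type*} [NormedAddCommGroup F] [InnerProductSpace ℝ F]
    (Ω : Set F) (φ : F → ℝ) : Prop :=
  ContDiff ℝ ∞ φ ∧ HasCompactSupport φ ∧ tsupport φ ⊆ Ω

/-- `w` is a derivative of `u` along the vector `θ` in the weak sense on `Ω`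
(to be used for `u, w ∈ L²(Ω)`). -/
def HasWeakDirDeriv {F : Type*} [NormedAddCommGroup F] [InnerProductSpace ℝ F] [MeasureSpace F]
    (Ω : Set F) (u w : F → ℝ) (θ : F) : Prop :=
  ∀ φ : F → ℝ, IsTestFunction Ω φ →
    ∫ x in Ω, u x * fderiv ℝ φ x θ = - ∫ x in Ω, w x * φ x

section WeakDeriv

variable {F : Type*} [NormedAddCommGroup F] [InnerProductSpace ℝ F] [MeasureSpace F]
  [BorelSpace F] [IsFiniteMeasureOnCompacts (volume : Measure F)]

theorem IsTestFunction.memLp {Ω : Set F} {φ : F → ℝ} (hφ : IsTestFunction Ω φ) :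
    MemLp φ 2 (volume.restrict Ω) :=
  (hφ.1.continuous.memLp_of_hasCompactSupport hφ.2.1).restrict Ω

theorem IsTestFunction.memLp_fderiv {Ω : Set F} {φ : F → ℝ} (hφ : IsTestFunction Ω φ) (θ : F) :
    MemLp (fun x => fderiv ℝ φ x θ) 2 (volume.restrict Ω) := by
  have hc : Continuous (fun x => fderiv ℝ φ x θ) :=
    (hφ.1.continuous_fderiv (by simp)).clm_apply continuous_const
  have hs : HasCompactSupport (fun x => fderiv ℝ φ x θ) := hφ.2.1.fderiv_apply ℝ θ
  exact (hc.memLp_of_hasCompactSupport hs).restrict Ω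

theorem HasWeakDirDeriv.lincomb {Ω : Set F} {u₁ w₁ u₂ w₂ u w : F → ℝ} {θ : F} {a b : ℝ}
    (h₁ : HasWeakDirDeriv Ω u₁ w₁ θ) (h₂ : HasWeakDirDeriv Ω u₂ w₂ θ)
    (hu₁ : MemLp u₁ 2 (volume.restrict Ω)) (hw₁ : MemLp w₁ 2 (volume.restrict Ω))
    (hu₂ : MemLp u₂ 2 (volume.restrict Ω)) (hw₂ : MemLp w₂ 2 (volume.restrict Ω))
    (hu : u =ᵐ[volume.restrict Ω] fun x => a * u₁ x + b * u₂ x)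
    (hw : w =ᵐ[volume.restrict Ω] fun x => a * w₁ x + b * w₂ x) :
    HasWeakDirDeriv Ω u w θ := by
  intro φ hφ
  have e₁ : ∫ x in Ω, u x * fderiv ℝ φ x θ =
      ∫ x in Ω, (a * (u₁ x * fderiv ℝ φ x θ) + b * (u₂ x * fderiv ℝ φ x θ)) := by
    refine integral_congr_ae ?_
    filter_upwards [hu] with x hx
    rw [hx]; ring
  have e₂ : ∫ x in Ω, w x * φ x =
      ∫ x in Ω, (a * (w₁ x * φ x) + b * (w₂ x * φ x)) := by
    refine integral_congr_ae ?_
    filter_upwards [hw] with x hx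
    rw [hx]; ring
  rw [e₁, e₂, integral_add, integral_add, integral_const_mul, integral_const_mul,
    integral_const_mul, integral_const_mul, h₁ φ hφ, h₂ φ hφ]
  · ring
  · exact (hw₁.integrable_mul hφ.memLp).const_mul a
  · exact (hw₂.integrable_mul hφ.memLp).const_mul b
  · exact (hu₁.integrable_mul (hφ.memLp_fderiv θ)).const_mul a
  · exact (hu₂.integrable_mul (hφ.memLp_fderiv θ)).const_mul b

end WeakDeriv

/-- `f ∈ H¹(J)` for an open set `J` of the real line. -/
def MemH1Line (J : Set ℝ) (f : ℝ → ℝ) : Prop :=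
  MemLp f 2 (volume.restrict J) ∧
    ∃ w : ℝ → ℝ, MemLp w 2 (volume.restrict J) ∧ HasWeakDirDeriv J f w 1

/-! ### The space `H¹(Ω)` -/

/-- `ℝ^d` with its Euclidean norm. -/
abbrev Eu (d : ℕ) : Type := EuclideanSpace ℝ (Fin d)

/-- The unit sphere of `ℝ^d`. -/
abbrev Sph (d : ℕ) : Type := Metric.sphere (0 : Eu d) 1

/-- `L²(Ω) × L²(Ω)^d` with its Hilbert norm. -/
abbrev L2Pair {d : ℕ} (Ω : Set (Eu d)) : Type :=
  WithLp 2 (Lp ℝ 2 (volume.restrict Ω) × Lp (Eu d) 2 (volume.restrict Ω))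

/-- The Sobolev space `H¹(Ω)`, realised as the space of pairs `(u, ∇u)` with `u ∈ L²(Ω)` and
`∇u ∈ L²(Ω)^d` the weak gradient of `u` (which `u` determines): for every vector `θ`, `θ · ∇u` is
the weak derivative of `u` along `θ`. The induced inner product is
`∫_Ω (u v + ∇u · ∇v)`. -/
def H1 {d : ℕ} (Ω : Set (Eu d)) : Submodule ℝ (L2Pair Ω) where
  carrier := {p | ∀ θ : Eu d, HasWeakDirDeriv Ω p.fst (fun x => inner ℝ θ (p.snd x)) θ}
  zero_mem' := by
    intro θ φ hφ
    have h₁ : ((0 : L2Pair Ω).fst : Eu d → ℝ) =ᵐ[volume.restrict Ω] 0 := Lp.coeFn_zero _ _ _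
    have h₂ : ((0 : L2Pair Ω).snd : Eu d → Eu d) =ᵐ[volume.restrict Ω] 0 := Lp.coeFn_zero _ _ _
    rw [integral_eq_zero_of_ae, integral_eq_zero_of_ae, neg_zero]
    · filter_upwards [h₂] with x hx
      simp only [hx, Pi.zero_apply, inner_zero_right, zero_mul]
    · filter_upwards [h₁] with x hx
      simp only [hx, Pi.zero_apply, zero_mul]
  add_mem' := by
    intro p q hp hq θ
    have h₁ : ((p + q).fst : Eu d → ℝ) =ᵐ[volume.restrict Ω] p.fst + q.fst := Lp.coeFn_add _ _
    have h₂ : ((p + q).snd : Eu d → Eu d) =ᵐ[volume.restrict Ω] p.snd + q.snd := Lp.coeFn_add _ _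
    refine HasWeakDirDeriv.lincomb (a := 1) (b := 1) (hp θ) (hq θ) (Lp.memLp _)
      ((Lp.memLp p.snd).const_inner θ) (Lp.memLp _) ((Lp.memLp q.snd).const_inner θ) ?_ ?_
    · filter_upwards [h₁] with x hx
      simp only [hx, Pi.add_apply, one_mul]
    · filter_upwards [h₂] with x hx
      simp only [hx, Pi.add_apply, inner_add_right, one_mul]
  smul_mem' := by
    intro c p hp θ
    have h₁ : ((c • p).fst : Eu d → ℝ) =ᵐ[volume.restrict Ω] c • ⇑p.fst := Lp.coeFn_smul _ _
    have h₂ : ((c • p).snd : Eu d → Eu d) =ᵐ[volume.restrict Ω] c • ⇑p.snd := Lp.coeFn_smul _ _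
    refine HasWeakDirDeriv.lincomb (a := c) (b := 0) (hp θ) (hp θ) (Lp.memLp _)
      ((Lp.memLp p.snd).const_inner θ) (Lp.memLp _) ((Lp.memLp p.snd).const_inner θ) ?_ ?_
    · filter_upwards [h₁] with x hx
      simp only [hx, Pi.smul_apply, smul_eq_mul, zero_mul, add_zero]
    · filter_upwards [h₂] with x hx
      simp only [hx, Pi.smul_apply, inner_smul_right, zero_mul, add_zero]

/-- The underlying element of `L²(Ω)`, as a function. -/
def H1val {d : ℕ} {Ω : Set (Eu d)} (u : H1 Ω) : Eu d → ℝ := (u : L2Pair Ω).fst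

/-- The weak directional derivative `∂_θ u = θ · ∇u`. -/
def H1dirDeriv {d : ℕ} {Ω : Set (Eu d)} (u : H1 Ω) (θ : Eu d) : Eu d → ℝ :=
  fun x => inner ℝ θ ((u : L2Pair Ω).snd x)

/-! ### Geometry of chords and the directional measures -/

/-- `δ_θ(x) = sup {s ≥ 0 : x + tθ ∈ Ω for all t ∈ ]0,s[}`. For `x ∈ Ω` the value `t = 0` may be
added without change. For a boundary point `x` from which the chord in the direction `θ` runs
inside `Ω`, this is the length of that chord, i.e. the extension by continuity along the chord of
the length of the whole chord. -/
def chordDist {d : ℕ} (Ω : Set (Eu d)) (θ x : Eu d) : ℝ :=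
  sSup {s : ℝ | 0 ≤ s ∧ ∀ t ∈ Ioo 0 s, x + t • θ ∈ Ω}

/-- `Φ_θ(x) = x + δ_θ(x) θ`, the first boundary point met from `x` in the direction `θ`; defined
both for `x ∈ Ω` and, by continuous extension along the chord, for `x` in the part of the boundary
that `Ω` sees in the direction `-θ`. -/
def Phi {d : ℕ} (Ω : Set (Eu d)) (θ x : Eu d) : Eu d := x + chordDist Ω θ x • θ

/-- `ℓ_{-θ}(z) = |Φ_{-θ}(z) - z|`, the length of the chord parallel to `θ` that ends at `z`. -/
def chordLen {d : ℕ} (Ω : Set (Eu d)) (θ z : Eu d) : ℝ := ‖Phi Ω (-θ) z - z‖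

/-- The directional measure `μ_θ`, `μ_θ(A) = ∫_Ω χ_A(Φ_θ(x)) dx`, as a measure on `ℝ^d` carried by
`∂Ω`. Functions on `∂Ω` are accordingly represented by functions on `ℝ^d`, whose values off `∂Ω`
play no role up to `μ_θ`-a.e. equality. -/
def dirMeasure {d : ℕ} (Ω : Set (Eu d)) (θ : Eu d) : Measure (Eu d) :=
  Measure.map (Phi Ω θ) (volume.restrict Ω)

/-! ### Directional traces -/

/-- The hyperplane `H_θ = θ^⊥`. -/
abbrev Hyp {d : ℕ} (θ : Eu d) : Submodule ℝ (Eu d) := (Submodule.span ℝ {θ})ᗮ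

/-- The `(d-1)`-dimensional Lebesgue measure on `H_θ`. -/
def hypMeasure {d : ℕ} (θ : Eu d) : Measure (Hyp θ) :=
  (stdOrthonormalBasis ℝ (Hyp θ)).toBasis.addHaar

/-- `𝒫_θ(Ω)`, the orthogonal projection of `Ω` on `H_θ`. -/
def projSet {d : ℕ} (Ω : Set (Eu d)) (θ : Eu d) : Set (Hyp θ) :=
  (Hyp θ).orthogonalProjectionOnto '' Ω

/-- `ω_θ(y) = {s : sθ + y ∈ Ω}`. -/
def lineSection {d : ℕ} (Ω : Set (Eu d)) (θ y : Eu d) : Set ℝ := {s | s • θ + y ∈ Ω}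

/-- `]α,β[` is one of the bounded open intervals that are the components of the open set `J`. -/
def IsComponentInterval (J : Set ℝ) (α β : ℝ) : Prop :=
  α < β ∧ Ioo α β ⊆ J ∧ α ∉ J ∧ β ∉ J

/-- `g` is a directional trace of (the class of) `u` in the direction `θ`. As usual, an element of
`H¹` of an interval is identified with its continuous representative, here `f`. -/
def IsDirTrace {d : ℕ} (Ω : Set (Eu d)) (θ : Eu d) (u g : Eu d → ℝ) : Prop :=
  ∃ v : Eu d → ℝ, v =ᵐ[volume.restrict Ω] u ∧
    ∃ A ⊆ projSet Ω θ, hypMeasure θ (projSet Ω θ \ A) = 0 ∧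
      ∀ y ∈ A,
        MemH1Line (lineSection Ω θ y) (fun s => v (s • θ + y)) ∧
        ∀ α β : ℝ, IsComponentInterval (lineSection Ω θ y) α β →
          ∃ f : ℝ → ℝ, ContinuousOn f (Ioc α β) ∧
            f =ᵐ[volume.restrict (Ioo α β)] (fun s => v (s • θ + y)) ∧
            g (β • θ + y) = f β

/-! ### The space `L²` for a family of measures -/

section FamilyL2

variable {X ι : Type*} [MeasurableSpace X]

/-- `𝓛²(X, (m_i)_i)`: the functions that are, for every `i`, `m_i`-a.e. equal to an element of
`𝓛²(X, m_i)`, with a bound on the norms that does not depend on `i`. -/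
def calL2 (m : ι → Measure X) : Submodule ℝ (X → ℝ) where
  carrier := {f | ∃ M : ℝ, ∀ i, MemLp f 2 (m i) ∧ (eLpNorm f 2 (m i)).toReal ≤ M}
  zero_mem' := ⟨0, fun i => ⟨MemLp.zero, by simp⟩⟩
  add_mem' := by
    rintro f g ⟨M, hf⟩ ⟨N, hg⟩
    refine ⟨M + N, fun i => ⟨(hf i).1.add (hg i).1, ?_⟩⟩
    refine le_trans ?_ (add_le_add (hf i).2 (hg i).2)
    rw [← ENNReal.toReal_add (hf i).1.2.ne (hg i).1.2.ne]
    exact ENNReal.toReal_mono (ENNReal.add_ne_top.2 ⟨(hf i).1.2.ne, (hg i).1.2.ne⟩)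
      (eLpNorm_add_le (hf i).1.1 (hg i).1.1 (by norm_num))
  smul_mem' := by
    rintro c f ⟨M, hf⟩
    refine ⟨‖c‖ * M, fun i => ⟨(hf i).1.const_smul c, ?_⟩⟩
    rw [eLpNorm_const_smul, ENNReal.toReal_mul, toReal_enorm]
    exact mul_le_mul_of_nonneg_left (hf i).2 (norm_nonneg c)

/-- `𝓛²(X, (m_i)_i)` as a type of its own, to carry the seminorm below. -/
def CalL2 (m : ι → Measure X) : Type _ := ↥(calL2 m)

variable (m : ι → Measure X)

instance : AddCommGroup (CalL2 m) := inferInstanceAs (AddCommGroup ↥(calL2 m))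

instance : Module ℝ (CalL2 m) := inferInstanceAs (Module ℝ ↥(calL2 m))

variable {m}

/-- The underlying function. -/
def CalL2.toFun (f : CalL2 m) : X → ℝ := Subtype.val f

theorem CalL2.memLp (f : CalL2 m) (i : ι) : MemLp f.toFun 2 (m i) :=
  (Subtype.property f).choose_spec i |>.1

theorem CalL2.bddAbove (f : CalL2 m) :
    BddAbove (range fun i => (eLpNorm f.toFun 2 (m i)).toReal) := by
  obtain ⟨M, hM⟩ := Subtype.property f
  exact ⟨M, by rintro _ ⟨i, rfl⟩; exact (hM i).2⟩

variable (m) in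
/-- `‖f‖ = sup_i ‖f‖_{L²(m_i)}`. -/
instance : Norm (CalL2 m) := ⟨fun f => ⨆ i, (eLpNorm f.toFun 2 (m i)).toReal⟩

theorem CalL2.norm_def (f : CalL2 m) : ‖f‖ = ⨆ i, (eLpNorm f.toFun 2 (m i)).toReal := rfl

theorem CalL2.core : SeminormedSpace.Core ℝ (CalL2 m) where
  norm_nonneg f := Real.iSup_nonneg fun _ => ENNReal.toReal_nonneg
  norm_smul c f := by
    have h : ∀ i, (eLpNorm (c • f).toFun 2 (m i)).toReal =
        ‖c‖ * (eLpNorm f.toFun 2 (m i)).toReal := by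
      intro i
      have : (c • f).toFun = c • f.toFun := rfl
      rw [this, eLpNorm_const_smul, ENNReal.toReal_mul, toReal_enorm]
    rw [CalL2.norm_def, CalL2.norm_def, Real.mul_iSup_of_nonneg (norm_nonneg c)]
    exact iSup_congr h
  norm_triangle f g := by
    rw [CalL2.norm_def, CalL2.norm_def, CalL2.norm_def]
    refine Real.iSup_le (fun i => ?_) (add_nonneg
      (Real.iSup_nonneg fun _ => ENNReal.toReal_nonneg)
      (Real.iSup_nonneg fun _ => ENNReal.toReal_nonneg))
    refine le_trans ?_ (add_le_add (le_ciSup f.bddAbove i) (le_ciSup g.bddAbove i))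
    have : (f + g).toFun = f.toFun + g.toFun := rfl
    rw [this, ← ENNReal.toReal_add (f.memLp i).2.ne (g.memLp i).2.ne]
    exact ENNReal.toReal_mono (ENNReal.add_ne_top.2 ⟨(f.memLp i).2.ne, (g.memLp i).2.ne⟩)
      (eLpNorm_add_le (f.memLp i).1 (g.memLp i).1 (by norm_num))

variable (m) in
instance : SeminormedAddCommGroup (CalL2 m) := SeminormedAddCommGroup.ofCore CalL2.core

variable (m) in
instance : NormedSpace ℝ (CalL2 m) := ⟨fun c f => (CalL2.core.norm_smul c f).le⟩

variable (m) in
/-- `L²(X, (m_i)_i)`: the equivalence classes of `𝓛²(X, (m_i)_i)` for the relation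
"`m_i`-a.e. equal for every `i`" (see `L2Family.mk_eq_mk_iff`), normed by
`‖f‖ = sup_i ‖f‖_{L²(m_i)}`. -/
abbrev L2Family : Type _ := SeparationQuotient (CalL2 m)

/-- The class of a function. -/
def L2Family.mk (f : X → ℝ) (hf : f ∈ calL2 m) : L2Family m :=
  SeparationQuotient.mk (show CalL2 m from ⟨f, hf⟩)

theorem L2Family.mk_eq_mk_iff (f g : X → ℝ) (hf : f ∈ calL2 m) (hg : g ∈ calL2 m) :
    L2Family.mk f hf = L2Family.mk g hg ↔ ∀ i, f =ᵐ[m i] g := by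
  let f' : CalL2 m := ⟨f, hf⟩
  let g' : CalL2 m := ⟨g, hg⟩
  have hfg : ∀ i, MemLp (f - g) 2 (m i) := fun i => (f'.memLp i).sub (g'.memLp i)
  have key : L2Family.mk f hf = L2Family.mk g hg ↔ ‖f' - g'‖ = 0 := by
    rw [← dist_eq_norm, ← Metric.inseparable_iff]
    exact SeparationQuotient.mk_eq_mk
  rw [key]
  have hfun : (f' - g').toFun = f - g := rfl
  have hiff : ∀ i, (eLpNorm (f - g) 2 (m i)).toReal = 0 ↔ f =ᵐ[m i] g := by
    intro i
    rw [ENNReal.toReal_eq_zero_iff, or_iff_left (hfg i).2.ne,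
      eLpNorm_eq_zero_iff (hfg i).1 (by norm_num)]
    exact sub_ae_eq_zero f g
  constructor
  · intro h i
    rw [← hiff i]
    refine le_antisymm ?_ ENNReal.toReal_nonneg
    rw [← h, ← hfun]
    exact le_ciSup (f' - g').bddAbove i
  · intro h
    rw [CalL2.norm_def, hfun]
    simp only [(hiff _).2 (h _)]
    exact Real.iSup_const_zero

end FamilyL2

/-! ### The omnidirectional trace -/

/-- The family `(μ_θ)` indexed by the unit sphere. -/
def dirMeasures {d : ℕ} (Ω : Set (Eu d)) : Sph d → Measure (Eu d) := fun θ => dirMeasure Ω θ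

/-- `g` is (a representative of) an omnidirectional trace of `u`: it belongs to
`𝓛²(∂Ω, (μ_θ)_θ)` and, for every direction `θ`, it coincides `μ_θ`-a.e. with a directional trace
of `u` in the direction `θ`. -/
def IsOmniTrace {d : ℕ} (Ω : Set (Eu d)) (u : H1 Ω) (g : Eu d → ℝ) : Prop :=
  g ∈ calL2 (dirMeasures Ω) ∧
    ∀ θ : Sph d, ∃ h : Eu d → ℝ, IsDirTrace Ω θ (H1val u) h ∧ h =ᵐ[dirMeasure Ω θ] g

theorem MemH1Line.lincomb {J : Set ℝ} {f₁ f₂ : ℝ → ℝ} (a b : ℝ)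
    (h₁ : MemH1Line J f₁) (h₂ : MemH1Line J f₂) :
    MemH1Line J (fun s => a * f₁ s + b * f₂ s) := by
  obtain ⟨hf₁, w₁, hw₁, hd₁⟩ := h₁
  obtain ⟨hf₂, w₂, hw₂, hd₂⟩ := h₂
  exact ⟨(hf₁.const_mul a).add (hf₂.const_mul b), fun s => a * w₁ s + b * w₂ s,
    (hw₁.const_mul a).add (hw₂.const_mul b),
    hd₁.lincomb hd₂ hf₁ hw₁ hf₂ hw₂ (ae_eq_refl _) (ae_eq_refl _)⟩

theorem IsDirTrace.lincomb {d : ℕ} {Ω : Set (Eu d)} {θ : Eu d} {u₁ u₂ u g₁ g₂ : Eu d → ℝ}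
    {a b : ℝ} (h₁ : IsDirTrace Ω θ u₁ g₁) (h₂ : IsDirTrace Ω θ u₂ g₂)
    (hu : u =ᵐ[volume.restrict Ω] fun x => a * u₁ x + b * u₂ x) :
    IsDirTrace Ω θ u (fun z => a * g₁ z + b * g₂ z) := by
  obtain ⟨v₁, hv₁, A₁, hA₁, hn₁, ht₁⟩ := h₁
  obtain ⟨v₂, hv₂, A₂, hA₂, hn₂, ht₂⟩ := h₂
  refine ⟨fun x => a * v₁ x + b * v₂ x, ?_, A₁ ∩ A₂, fun y hy => hA₁ hy.1, ?_, ?_⟩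
  · filter_upwards [hv₁, hv₂, hu] with x h₁ h₂ h₃
    rw [h₁, h₂, h₃]
  · rw [sdiff_inter]
    exact measure_union_null hn₁ hn₂
  · rintro y ⟨hy₁, hy₂⟩
    refine ⟨(ht₁ y hy₁).1.lincomb a b (ht₂ y hy₂).1, fun α β hαβ => ?_⟩
    obtain ⟨f₁, hc₁, he₁, hg₁⟩ := (ht₁ y hy₁).2 α β hαβ
    obtain ⟨f₂, hc₂, he₂, hg₂⟩ := (ht₂ y hy₂).2 α β hαβ
    refine ⟨fun s => a * f₁ s + b * f₂ s,
      (continuousOn_const.mul hc₁).add (continuousOn_const.mul hc₂), ?_, ?_⟩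
    · filter_upwards [he₁, he₂] with s h₁ h₂
      rw [h₁, h₂]
    · simp only [hg₁, hg₂]

theorem IsOmniTrace.lincomb {d : ℕ} {Ω : Set (Eu d)} {u₁ u₂ u : H1 Ω} {g₁ g₂ : Eu d → ℝ}
    {a b : ℝ} (h₁ : IsOmniTrace Ω u₁ g₁) (h₂ : IsOmniTrace Ω u₂ g₂)
    (hu : H1val u =ᵐ[volume.restrict Ω] fun x => a * H1val u₁ x + b * H1val u₂ x) :
    IsOmniTrace Ω u (fun z => a * g₁ z + b * g₂ z) := by
  refine ⟨Submodule.add_mem _ (Submodule.smul_mem _ a h₁.1) (Submodule.smul_mem _ b h₂.1),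
    fun θ => ?_⟩
  obtain ⟨k₁, hk₁, he₁⟩ := h₁.2 θ
  obtain ⟨k₂, hk₂, he₂⟩ := h₂.2 θ
  refine ⟨_, hk₁.lincomb hk₂ hu, ?_⟩
  filter_upwards [he₁, he₂] with z h₁ h₂
  rw [h₁, h₂]

theorem isOmniTrace_zero {d : ℕ} (Ω : Set (Eu d)) : IsOmniTrace Ω 0 0 := by
  refine ⟨Submodule.zero_mem _, fun θ => ⟨0, ⟨0, (Lp.coeFn_zero _ _ _).symm, projSet Ω θ,
    Subset.rfl, by simp, fun y _ => ⟨⟨MemLp.zero', 0, MemLp.zero, ?_⟩, ?_⟩⟩, ae_eq_refl _⟩⟩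
  · intro φ _
    simp
  · intro α β _
    exact ⟨fun _ => 0, continuousOn_const, ae_eq_refl _, rfl⟩

/-- `H¹_tr(Ω)`: the elements of `H¹(Ω)` having an omnidirectional trace on `∂Ω`, with the norm
and inner product of `H¹(Ω)`. -/
def H1tr {d : ℕ} (Ω : Set (Eu d)) : Submodule ℝ (H1 Ω) where
  carrier := {u | ∃ g, IsOmniTrace Ω u g}
  zero_mem' := ⟨0, isOmniTrace_zero Ω⟩
  add_mem' := by
    rintro u v ⟨g, hg⟩ ⟨h, hh⟩
    refine ⟨_, hg.lincomb (a := 1) (b := 1) hh ?_⟩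
    filter_upwards [Lp.coeFn_add (u : L2Pair Ω).fst (v : L2Pair Ω).fst] with x hx
    rw [one_mul, one_mul]
    exact hx
  smul_mem' := by
    rintro c u ⟨g, hg⟩
    refine ⟨_, hg.lincomb (a := c) (b := 0) hg ?_⟩
    filter_upwards [Lp.coeFn_smul c (u : L2Pair Ω).fst] with x hx
    rw [zero_mul, add_zero]
    exact hx

/-- The space `L²(∂Ω, (μ_θ)_θ)`. -/
abbrev BoundaryL2 {d : ℕ} (Ω : Set (Eu d)) : Type := L2Family (dirMeasures Ω)

/-- The omnidirectional trace operator: the class of an omnidirectional trace of `u`. -/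
def tr {d : ℕ} (Ω : Set (Eu d)) (u : H1tr Ω) : BoundaryL2 Ω :=
  L2Family.mk u.2.choose u.2.choose_spec.1

end OmniTrace

end

open OmniTrace

/-!
Along almost every chord of `Ω` parallel to `θ`, a function `u ∈ H¹(Ω)` is a primitive of `∂_θ u`,
so it has a boundary value at the exit point `Φ_θ(x)`, namely `u(x)` plus the integral of `∂_θ u`
over the part of the chord ahead of `x`. As `μ_θ` is the image of Lebesgue measure under `Φ_θ`, a
function `g` is a directional trace of `u` exactly when `g ∘ Φ_θ` is this boundary value a.e.

Choosing a point of `Ω` and then moving it uniformly along its chord preserves Lebesgue measure.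
Together with Jensen's inequality this bounds the boundary value in `L²(Ω)`, uniformly in `θ`, by
`(1 + diam Ω) ‖u‖`; together with the one-dimensional integration by parts on each chord it gives
the formula on `Ω`. Since being a trace is a closed condition on the pair `(u, g)` in the complete
space `H¹(Ω) × 𝓛²`, and `g` is controlled by `u`, the domain of the trace operator is closed.
-/

noncomputable section

namespace OmniTrace

/-! ### Chords of an open set -/

section Chord

variable {F : Type*} [NormedAddCommGroup F] [NormedSpace ℝ F]

/-- The chord of `Ω` through `x` parallel to `θ`, as a set of parameters: those `t` for which the
segment from `x` to `x + tθ` lies in `Ω`. -/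
def chord (Ω : Set F) (θ x : F) : Set ℝ := {t | ∀ τ ∈ uIcc 0 t, x + τ • θ ∈ Ω}

/-- The time `δ_θ(x)` at which the ray from `x` in the direction `θ` leaves `Ω`. This is
`chordDist`, in an arbitrary normed space so as to apply to the sections of `Ω` as well. -/
def exitTime (Ω : Set F) (θ x : F) : ℝ :=
  sSup {s : ℝ | 0 ≤ s ∧ ∀ t ∈ Ioo 0 s, x + t • θ ∈ Ω}

variable {Ω : Set F} {θ x : F} {t : ℝ}

theorem mem_of_mem_chord (h : t ∈ chord Ω θ x) : x ∈ Ω := by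
  simpa using h 0 left_mem_uIcc

theorem add_smul_mem_of_mem_chord (h : t ∈ chord Ω θ x) : x + t • θ ∈ Ω :=
  h t right_mem_uIcc

theorem zero_mem_chord (h : x ∈ Ω) : (0 : ℝ) ∈ chord Ω θ x := by
  simpa [chord] using h

theorem chord_eq_empty (h : x ∉ Ω) : chord Ω θ x = ∅ :=
  eq_empty_of_forall_notMem fun _ ht => h (mem_of_mem_chord ht)

theorem chord_neg (Ω : Set F) (θ x : F) : chord Ω (-θ) x = Neg.neg ⁻¹' chord Ω θ x := by
  ext t
  refine ⟨fun h τ hτ => ?_, fun h τ hτ => ?_⟩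
  · simpa using h (-τ) (by rw [mem_uIcc] at *; grind)
  · simpa using h (-τ) (by rw [mem_uIcc] at *; grind)

theorem chord_add_smul (ht : t ∈ chord Ω θ x) :
    chord Ω θ (x + t • θ) = (t + ·) ⁻¹' chord Ω θ x := by
  have shift (τ : ℝ) : x + t • θ + τ • θ = x + (t + τ) • θ := by rw [add_smul, add_assoc]
  ext s
  refine ⟨fun h τ hτ => ?_, fun h τ hτ => ?_⟩
  · by_cases hτt : τ ∈ uIcc 0 t
    · exact ht τ hτt
    · simpa [shift] using h (τ - t) (by rw [mem_uIcc] at *; grind)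
  · rw [shift]
    by_cases hτt : t + τ ∈ uIcc 0 t
    · exact ht _ hτt
    · exact h _ (by rw [mem_uIcc] at *; grind)

theorem neg_mem_chord_add_smul_iff : -t ∈ chord Ω θ (x + t • θ) ↔ t ∈ chord Ω θ x := by
  have mp {x : F} {t : ℝ} (ht : t ∈ chord Ω θ x) : -t ∈ chord Ω θ (x + t • θ) := by
    rw [chord_add_smul ht]
    simpa using zero_mem_chord (mem_of_mem_chord ht)
  exact ⟨fun h => by simpa [add_assoc] using mp h, mp⟩

theorem volume_chord_add_smul (ht : t ∈ chord Ω θ x) :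
    volume (chord Ω θ (x + t • θ)) = volume (chord Ω θ x) := by
  rw [chord_add_smul ht, measure_preimage_add]

theorem isOpen_setOf_mem_chord (hΩ : IsOpen Ω) (θ : F) :
    IsOpen {p : F × ℝ | p.2 ∈ chord Ω θ p.1} := by
  have key (p : F × ℝ) : p.2 ∈ chord Ω θ p.1 ↔ ∀ σ ∈ Icc (0 : ℝ) 1, p.1 + (σ * p.2) • θ ∈ Ω := by
    rw [chord, mem_ofPred_eq, ← segment_eq_uIcc, segment_eq_image, forall_mem_image]
    simp
  rw [isOpen_iff_eventually]
  intro p hp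
  simp only [mem_ofPred_eq, key] at hp ⊢
  refine isCompact_Icc.eventually_forall_of_forall_eventually fun σ hσ => ?_
  have hc : Continuous fun z : (F × ℝ) × ℝ => z.1.1 + (z.2 * z.1.2) • θ := by fun_prop
  exact hc.continuousAt.eventually_mem (hΩ.mem_nhds (hp σ hσ))

theorem isOpen_chord (hΩ : IsOpen Ω) (θ x : F) : IsOpen (chord Ω θ x) :=
  (isOpen_setOf_mem_chord hΩ θ).preimage (Continuous.prodMk_right x)

theorem isOpen_setOf_fixed_mem_chord (hΩ : IsOpen Ω) (θ : F) (t : ℝ) :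
    IsOpen {x | t ∈ chord Ω θ x} :=
  (isOpen_setOf_mem_chord hΩ θ).preimage (Continuous.prodMk_left t)

theorem volume_chord_ne_zero (hΩ : IsOpen Ω) (θ : F) (hx : x ∈ Ω) : volume (chord Ω θ x) ≠ 0 :=
  ((isOpen_chord hΩ θ x).measure_pos volume ⟨0, zero_mem_chord hx⟩).ne'

theorem dist_add_smul_add_smul (x θ : F) (s t : ℝ) :
    dist (x + s • θ) (x + t • θ) = dist s t * ‖θ‖ := by
  rw [dist_add_left, dist_eq_norm, dist_eq_norm, ← sub_smul, norm_smul]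

theorem isBounded_setOf_add_smul_mem (hb : Bornology.IsBounded Ω) (hθ : θ ≠ 0) (x : F) :
    Bornology.IsBounded {t : ℝ | x + t • θ ∈ Ω} := by
  have h : AntilipschitzWith ‖θ‖₊⁻¹ fun t : ℝ => x + t • θ :=
    AntilipschitzWith.of_le_mul_dist fun s t => by
      rw [dist_add_smul_add_smul, NNReal.coe_inv, coe_nnnorm, mul_comm,
        mul_inv_cancel_right₀ (norm_ne_zero_iff.2 hθ)]
  exact h.isBounded_preimage hb

theorem isBounded_chord (hb : Bornology.IsBounded Ω) (hθ : θ ≠ 0) (x : F) :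
    Bornology.IsBounded (chord Ω θ x) :=
  (isBounded_setOf_add_smul_mem hb hθ x).subset fun _ => add_smul_mem_of_mem_chord

theorem volume_chord_ne_top (hb : Bornology.IsBounded Ω) (hθ : θ ≠ 0) (x : F) :
    volume (chord Ω θ x) ≠ ⊤ :=
  (isBounded_chord hb hθ x).measure_lt_top.ne

theorem volume_chord_le_ediam (hθ : ‖θ‖ = 1) (Ω : Set F) (x : F) :
    volume (chord Ω θ x) ≤ Metric.ediam Ω := by
  have h : Isometry fun t : ℝ => x + t • θ := Isometry.of_dist_eq fun s t => by
    rw [dist_add_smul_add_smul, hθ, mul_one]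
  calc volume (chord Ω θ x) ≤ Metric.ediam (chord Ω θ x) := Real.volume_le_diam _
    _ = Metric.ediam ((fun t : ℝ => x + t • θ) '' chord Ω θ x) := (h.ediam_image _).symm
    _ ≤ Metric.ediam Ω := Metric.ediam_mono (by
      rintro _ ⟨t, ht, rfl⟩
      exact add_smul_mem_of_mem_chord ht)

theorem exitTime_eq {b : ℝ} (hb : 0 < b) (h : ∀ t ∈ Ioo 0 b, x + t • θ ∈ Ω)
    (hn : x + b • θ ∉ Ω) : exitTime Ω θ x = b := by
  have : {s : ℝ | 0 ≤ s ∧ ∀ t ∈ Ioo 0 s, x + t • θ ∈ Ω} = Icc 0 b := by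
    ext s
    refine ⟨fun hs => ⟨hs.1, ?_⟩, fun hs => ⟨hs.1, fun t ht => h t ⟨ht.1, ht.2.trans_le hs.2⟩⟩⟩
    by_contra! hlt
    exact hn (hs.2 b ⟨hb, hlt⟩)
  rw [exitTime, this, csSup_Icc hb.le]

theorem bddAbove_setOf_forall_Ioo_mem (hb : Bornology.IsBounded Ω) (hθ : θ ≠ 0) (x : F) :
    BddAbove {s : ℝ | 0 ≤ s ∧ ∀ t ∈ Ioo 0 s, x + t • θ ∈ Ω} := by
  obtain ⟨M, hM⟩ := (isBounded_setOf_add_smul_mem hb hθ x).bddAbove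
  refine ⟨max 0 M, fun s hs => ?_⟩
  by_contra! hlt
  obtain ⟨t, hMt, hts⟩ := exists_between hlt
  have ht : t ≤ M := hM (hs.2 t ⟨(le_max_left 0 M).trans_lt hMt, hts⟩)
  exact absurd (le_max_right 0 M) (hMt.trans_le ht).not_ge

theorem add_smul_mem_of_lt_exitTime (hx : x ∈ Ω) (ht0 : 0 ≤ t) (ht : t < exitTime Ω θ x) :
    x + t • θ ∈ Ω := by
  rcases ht0.eq_or_lt with rfl | h0
  · simpa using hx
  · have hne : {s : ℝ | 0 ≤ s ∧ ∀ t ∈ Ioo 0 s, x + t • θ ∈ Ω}.Nonempty := ⟨0, le_rfl, by simp⟩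
    obtain ⟨s, hs, hts⟩ := exists_lt_of_lt_csSup hne ht
    exact hs.2 t ⟨h0, hts⟩

theorem lt_exitTime_of_mem_chord (hΩ : IsOpen Ω) (hb : Bornology.IsBounded Ω) (hθ : θ ≠ 0)
    (ht0 : 0 ≤ t) (ht : t ∈ chord Ω θ x) : t < exitTime Ω θ x := by
  have hnhds : ∀ᶠ s in 𝓝[>] t, s ∈ chord Ω θ x :=
    nhdsWithin_le_nhds ((isOpen_chord hΩ θ x).mem_nhds ht)
  obtain ⟨s, hs, hts⟩ := (hnhds.and self_mem_nhdsWithin).exists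
  have hs0 : 0 ≤ s := ht0.trans hts.le
  refine hts.trans_le (le_csSup (bddAbove_setOf_forall_Ioo_mem hb hθ x) ⟨hs0, fun τ hτ => hs τ ?_⟩)
  rw [uIcc_of_le hs0]
  exact Ioo_subset_Icc_self hτ

theorem exitTime_pos (hΩ : IsOpen Ω) (hb : Bornology.IsBounded Ω) (hθ : θ ≠ 0) (hx : x ∈ Ω) :
    0 < exitTime Ω θ x :=
  lt_exitTime_of_mem_chord hΩ hb hθ le_rfl (zero_mem_chord hx)

theorem mem_chord_iff_lt_exitTime (hΩ : IsOpen Ω) (hb : Bornology.IsBounded Ω) (hθ : θ ≠ 0)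
    (hx : x ∈ Ω) (ht : 0 ≤ t) : t ∈ chord Ω θ x ↔ t < exitTime Ω θ x := by
  refine ⟨lt_exitTime_of_mem_chord hΩ hb hθ ht, fun h τ hτ => ?_⟩
  rw [uIcc_of_le ht] at hτ
  exact add_smul_mem_of_lt_exitTime hx hτ.1 (hτ.2.trans_lt h)

theorem add_exitTime_smul_notMem (hΩ : IsOpen Ω) (hb : Bornology.IsBounded Ω) (hθ : θ ≠ 0)
    (hx : x ∈ Ω) : x + exitTime Ω θ x • θ ∉ Ω := by
  intro h
  have hpos := exitTime_pos hΩ hb hθ hx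
  refine lt_irrefl _ (lt_exitTime_of_mem_chord hΩ hb hθ hpos.le fun τ hτ => ?_)
  rw [uIcc_of_le hpos.le] at hτ
  rcases hτ.2.eq_or_lt with rfl | hlt
  · exact h
  · exact add_smul_mem_of_lt_exitTime hx hτ.1 hlt

theorem chord_eq_Ioo (hΩ : IsOpen Ω) (hb : Bornology.IsBounded Ω) (hθ : θ ≠ 0) (hx : x ∈ Ω) :
    chord Ω θ x = Ioo (-exitTime Ω (-θ) x) (exitTime Ω θ x) := by
  have hpos := exitTime_pos hΩ hb hθ hx
  have hneg := exitTime_pos hΩ hb (neg_ne_zero.2 hθ) hx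
  ext t
  rcases le_total 0 t with h0 | h0
  · rw [mem_chord_iff_lt_exitTime hΩ hb hθ hx h0, mem_Ioo, iff_and_self]
    exact fun _ => by linarith
  · have h := mem_chord_iff_lt_exitTime hΩ hb (neg_ne_zero.2 hθ) hx (neg_nonneg.2 h0)
    rw [chord_neg, mem_preimage, neg_neg] at h
    rw [h, mem_Ioo, neg_lt, iff_self_and]
    exact fun _ => h0.trans_lt hpos

theorem volume_chord (hΩ : IsOpen Ω) (hb : Bornology.IsBounded Ω) (hθ : θ ≠ 0) (hx : x ∈ Ω) :
    volume (chord Ω θ x) = ENNReal.ofReal (exitTime Ω θ x + exitTime Ω (-θ) x) := by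
  rw [chord_eq_Ioo hΩ hb hθ hx, Real.volume_Ioo, sub_neg_eq_add]

end Chord

/-! ### Averaging over chords -/

section ChordKernel

open ProbabilityTheory

variable {F : Type*} [NormedAddCommGroup F] [NormedSpace ℝ F]

/-- The shear `(x, t) ↦ (x + tθ, -t)`, an involution. -/
def shear (θ : F) (p : F × ℝ) : F × ℝ := (p.1 + p.2 • θ, -p.2)

/-- The density, with respect to Lebesgue measure, of the distribution of a point `x` of `Ω`
together with a uniformly distributed parameter of its chord. -/
def chordDensity (Ω : Set F) (θ : F) : F × ℝ → ℝ≥0∞ :=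
  {p : F × ℝ | p.2 ∈ chord Ω θ p.1}.indicator fun p => (volume (chord Ω θ p.1))⁻¹

theorem chordDensity_shear (Ω : Set F) (θ : F) (p : F × ℝ) :
    chordDensity Ω θ (shear θ p) = chordDensity Ω θ p := by
  by_cases hp : p.2 ∈ chord Ω θ p.1
  · have hp' : (shear θ p).2 ∈ chord Ω θ (shear θ p).1 := neg_mem_chord_add_smul_iff.2 hp
    unfold chordDensity
    rw [indicator_of_mem (a := p) hp, indicator_of_mem (a := shear θ p) hp', shear,
      volume_chord_add_smul hp]
  · have hp' : (shear θ p).2 ∉ chord Ω θ (shear θ p).1 := neg_mem_chord_add_smul_iff.not.2 hp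
    unfold chordDensity
    rw [indicator_of_notMem (a := p) hp, indicator_of_notMem (a := shear θ p) hp']

variable [MeasureSpace F] [BorelSpace F]

theorem measurable_volume_chord_inter {Ω : Set F} (hΩ : IsOpen Ω) (θ : F) {s : Set (F × ℝ)}
    (hs : MeasurableSet s) : Measurable fun x => volume (chord Ω θ x ∩ Prod.mk x ⁻¹' s) :=
  measurable_measure_prodMk_left (ν := (volume : Measure ℝ))
    ((isOpen_setOf_mem_chord hΩ θ).measurableSet.inter hs)

theorem measurable_volume_chord {Ω : Set F} (hΩ : IsOpen Ω) (θ : F) :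
    Measurable fun x => volume (chord Ω θ x) := by
  simpa using measurable_volume_chord_inter hΩ θ MeasurableSet.univ

/-- The kernel sending a point of `Ω` to the uniform probability distribution on its chord
parallel to `θ`, and a point outside `Ω` to `0`. -/
def chordKernel {Ω : Set F} (hΩ : IsOpen Ω) (θ : F) : Kernel F ℝ where
  toFun x := volume[|chord Ω θ x]
  measurable' := by
    refine Measure.measurable_of_measurable_coe _ fun s hs => ?_
    simp only [cond_apply (isOpen_chord hΩ θ _).measurableSet]
    exact (measurable_volume_chord hΩ θ).inv.mul
      (measurable_volume_chord_inter hΩ θ (measurable_snd hs))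

instance {Ω : Set F} (hΩ : IsOpen Ω) (θ : F) : IsFiniteKernel (chordKernel hΩ θ) where
  exists_univ_le := ⟨1, ENNReal.one_lt_top, fun x => by
    rw [chordKernel, Kernel.coe_mk, cond_apply (isOpen_chord hΩ θ x).measurableSet, inter_univ]
    exact ENNReal.inv_mul_le_one _⟩

variable {Ω : Set F} {θ x : F}

theorem chordKernel_apply (hΩ : IsOpen Ω) (θ x : F) :
    chordKernel hΩ θ x = (volume (chord Ω θ x))⁻¹ • volume.restrict (chord Ω θ x) := rfl

theorem integral_chordKernel (hΩ : IsOpen Ω) (θ x : F) (g : ℝ → ℝ) :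
    ∫ t, g t ∂(chordKernel hΩ θ x) =
      (volume (chord Ω θ x)).toReal⁻¹ * ∫ t in chord Ω θ x, g t := by
  rw [chordKernel_apply, integral_smul_measure, ENNReal.toReal_inv, smul_eq_mul]

theorem restrict_chord_eq_smul_chordKernel (hΩ : IsOpen Ω) (hb : Bornology.IsBounded Ω)
    (hθ : θ ≠ 0) (hx : x ∈ Ω) :
    volume.restrict (chord Ω θ x) = volume (chord Ω θ x) • chordKernel hΩ θ x := by
  rw [chordKernel_apply, smul_smul, ENNReal.mul_inv_cancel (volume_chord_ne_zero hΩ θ hx)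
    (volume_chord_ne_top hb hθ x), one_smul]

theorem isProbabilityMeasure_chordKernel (hΩ : IsOpen Ω) (hb : Bornology.IsBounded Ω)
    (hθ : θ ≠ 0) (hx : x ∈ Ω) : IsProbabilityMeasure (chordKernel hΩ θ x) :=
  cond_isProbabilityMeasure_of_finite (volume_chord_ne_zero hΩ θ hx) (volume_chord_ne_top hb hθ x)

theorem measurable_chordDensity (hΩ : IsOpen Ω) (θ : F) : Measurable (chordDensity Ω θ) :=
  ((measurable_volume_chord hΩ θ).comp measurable_fst).inv.indicator
    (isOpen_setOf_mem_chord hΩ θ).measurableSet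

variable [FiniteDimensional ℝ F] [(volume : Measure F).IsAddHaarMeasure]

theorem measurePreserving_shear (θ : F) :
    MeasurePreserving (shear θ) ((volume : Measure F).prod (volume : Measure ℝ))
      ((volume : Measure F).prod (volume : Measure ℝ)) := by
  have h : MeasurePreserving (fun p : ℝ × F => (-p.1, p.2 + p.1 • θ))
      ((volume : Measure ℝ).prod (volume : Measure F))
      ((volume : Measure ℝ).prod (volume : Measure F)) :=
    (Measure.measurePreserving_neg (volume : Measure ℝ)).skew_product
      (g := fun t x => x + t • θ) (by fun_prop) (.of_forall fun _ => map_add_right_eq_self _ _)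
  exact (Measure.measurePreserving_swap.comp h).comp Measure.measurePreserving_swap

theorem compProd_chordKernel (hΩ : IsOpen Ω) (θ : F) :
    (volume.restrict Ω) ⊗ₘ chordKernel hΩ θ =
      ((volume : Measure F).prod (volume : Measure ℝ)).withDensity (chordDensity Ω θ) := by
  ext s hs
  have hd := measurable_chordDensity hΩ θ
  rw [Measure.compProd_apply hs, withDensity_apply _ hs, ← lintegral_indicator hs,
    lintegral_prod _ (hd.indicator hs).aemeasurable, ← lintegral_indicator hΩ.measurableSet]
  refine lintegral_congr fun x => ?_
  have hfib : (fun t => s.indicator (chordDensity Ω θ) (x, t)) =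
      (Prod.mk x ⁻¹' s).indicator
        ((chord Ω θ x).indicator fun _ => (volume (chord Ω θ x))⁻¹) := rfl
  rw [hfib, lintegral_indicator (measurable_prodMk_left hs),
    lintegral_indicator_const (isOpen_chord hΩ θ x).measurableSet]
  by_cases hx : x ∈ Ω
  · rw [indicator_of_mem hx, chordKernel_apply, Measure.smul_apply, smul_eq_mul,
      Measure.restrict_apply (measurable_prodMk_left hs),
      Measure.restrict_apply (isOpen_chord hΩ θ x).measurableSet, inter_comm]
  · simp [hx, chord_eq_empty hx]

theorem measurePreserving_shear_compProd (hΩ : IsOpen Ω) (θ : F) :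
    MeasurePreserving (shear θ) ((volume.restrict Ω) ⊗ₘ chordKernel hΩ θ)
      ((volume.restrict Ω) ⊗ₘ chordKernel hΩ θ) := by
  have hshear := measurePreserving_shear θ
  refine ⟨hshear.measurable, Measure.ext fun s hs => ?_⟩
  rw [Measure.map_apply hshear.measurable hs, compProd_chordKernel, withDensity_apply _ hs,
    withDensity_apply _ (hshear.measurable hs),
    ← hshear.setLIntegral_comp_preimage hs (measurable_chordDensity hΩ θ)]
  simp only [chordDensity_shear]

theorem measurePreserving_add_smul (hΩ : IsOpen Ω) (hb : Bornology.IsBounded Ω) (hθ : θ ≠ 0) :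
    MeasurePreserving (fun p : F × ℝ => p.1 + p.2 • θ)
      ((volume.restrict Ω) ⊗ₘ chordKernel hΩ θ) (volume.restrict Ω) := by
  have hfst : MeasurePreserving Prod.fst ((volume.restrict Ω) ⊗ₘ chordKernel hΩ θ)
      (volume.restrict Ω) := by
    refine ⟨measurable_fst, Measure.ext fun s hs => ?_⟩
    have hone : ∀ᵐ x ∂volume.restrict Ω, chordKernel hΩ θ x univ = 1 :=
      ae_restrict_of_forall_mem hΩ.measurableSet fun x hx =>
        (isProbabilityMeasure_chordKernel hΩ hb hθ hx).measure_univ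
    rw [Measure.map_apply measurable_fst hs, ← prod_univ,
      Measure.compProd_apply_prod hs MeasurableSet.univ,
      lintegral_congr_ae (ae_restrict_of_ae hone), setLIntegral_one]
  exact hfst.comp (measurePreserving_shear_compProd hΩ θ)

theorem integrable_integral_chordKernel (hΩ : IsOpen Ω) (hb : Bornology.IsBounded Ω) (hθ : θ ≠ 0)
    {f : F → ℝ} (hf : IntegrableOn f Ω) :
    IntegrableOn (fun x => ∫ t, f (x + t • θ) ∂(chordKernel hΩ θ x)) Ω := by
  have hcomp := (measurePreserving_add_smul hΩ hb hθ).integrable_comp_of_integrable hf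
  simpa [IntegrableOn] using Integrable.integral_compProd (a := ()) hcomp

theorem integral_integral_chordKernel (hΩ : IsOpen Ω) (hb : Bornology.IsBounded Ω) (hθ : θ ≠ 0)
    {f : F → ℝ} (hf : IntegrableOn f Ω) :
    ∫ x in Ω, ∫ t, f (x + t • θ) ∂(chordKernel hΩ θ x) = ∫ x in Ω, f x := by
  have hmp := measurePreserving_add_smul hΩ hb hθ
  calc ∫ x in Ω, ∫ t, f (x + t • θ) ∂(chordKernel hΩ θ x)
      = ∫ p, f (p.1 + p.2 • θ) ∂((volume.restrict Ω) ⊗ₘ chordKernel hΩ θ) :=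
        (Measure.integral_compProd (hmp.integrable_comp_of_integrable hf)).symm
    _ = ∫ x in Ω, f x := by
        rw [← integral_map hmp.aemeasurable (by rw [hmp.map_eq]; exact hf.1), hmp.map_eq]

theorem ae_integrableOn_chord (hΩ : IsOpen Ω) (hb : Bornology.IsBounded Ω) (hθ : θ ≠ 0)
    {f : F → ℝ} (hf : IntegrableOn f Ω) :
    ∀ᵐ x ∂volume.restrict Ω, IntegrableOn (fun t => f (x + t • θ)) (chord Ω θ x) := by
  have hcomp := (measurePreserving_add_smul hΩ hb hθ).integrable_comp_of_integrable hf
  filter_upwards [((Measure.integrable_compProd_iff hcomp.1).1 hcomp).1,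
    ae_restrict_mem hΩ.measurableSet] with x hx hxΩ
  rw [IntegrableOn, restrict_chord_eq_smul_chordKernel hΩ hb hθ hxΩ]
  exact hx.smul_measure (volume_chord_ne_top hb hθ x)

end ChordKernel

/-! ### Absolute continuity along chords -/

section ACL

variable {F : Type*} [NormedAddCommGroup F] [InnerProductSpace ℝ F] {Ω : Set F} {φ : F → ℝ}

theorem isTestFunction_comp_sub (hφ : ContDiff ℝ ∞ φ) (hc : HasCompactSupport φ) {a : F}
    (h : ∀ x ∈ tsupport φ, x + a ∈ Ω) : IsTestFunction Ω fun x => φ (x - a) := by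
  refine ⟨hφ.comp (contDiff_id.sub contDiff_const), hc.comp_homeomorph (Homeomorph.subRight a),
    fun x hx => ?_⟩
  have : x - a ∈ tsupport φ :=
    tsupport_comp_subset_preimage φ (f := fun x => x - a) (by fun_prop) hx
  simpa using h _ this

theorem HasWeakDirDeriv.integral_indicator_mul_fderiv [MeasureSpace F] {u w : F → ℝ} {θ : F}
    (h : HasWeakDirDeriv Ω u w θ) (hΩ : MeasurableSet Ω) (hφ : IsTestFunction Ω φ) :
    ∫ x, Ω.indicator u x * fderiv ℝ φ x θ = -∫ x, Ω.indicator w x * φ x := by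
  have hφΩ := h φ hφ
  rw [← integral_indicator hΩ, ← integral_indicator hΩ] at hφΩ
  simpa only [indicator_mul_left] using hφΩ

theorem integral_fderiv_line (hφ : ContDiff ℝ 1 φ) (θ x : F) (t : ℝ) :
    ∫ τ in (0 : ℝ)..t, fderiv ℝ φ (x + τ • θ) θ = φ (x + t • θ) - φ x := by
  have hderiv (τ : ℝ) : HasDerivAt (fun σ : ℝ => φ (x + σ • θ)) (fderiv ℝ φ (x + τ • θ) θ) τ := by
    have h : HasDerivAt (fun σ : ℝ => x + σ • θ) θ τ := by
      simpa using ((hasDerivAt_id τ).smul_const θ).const_add x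
    exact (hφ.differentiable one_ne_zero (x + τ • θ)).hasFDerivAt.comp_hasDerivAt τ h
  have : Continuous (fderiv ℝ φ) := hφ.continuous_fderiv one_ne_zero
  rw [intervalIntegral.integral_eq_sub_of_hasDerivAt (f := fun σ : ℝ => φ (x + σ • θ))
    (fun τ _ => hderiv τ) (Continuous.intervalIntegrable (by fun_prop) _ _), zero_smul, add_zero]

theorem sub_eq_neg_integral_fderiv (hφ : ContDiff ℝ 1 φ) (θ x : F) (t : ℝ) :
    φ (x - t • θ) - φ x = -∫ τ in (0 : ℝ)..t, fderiv ℝ φ (x - τ • θ) θ := by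
  simpa [sub_eq_add_neg] using (integral_fderiv_line hφ (-θ) x t).symm

instance isFiniteMeasure_restrict_uIoc (a b : ℝ) :
    IsFiniteMeasure ((volume : Measure ℝ).restrict (uIoc a b)) :=
  inferInstanceAs (IsFiniteMeasure (volume.restrict (Ioc _ _)))

theorem integral_comp_add_mul {G : Type*} [AddGroup G] [MeasureSpace G] [MeasurableAdd G]
    [(volume : Measure G).IsAddRightInvariant] (f g : G → ℝ) (a : G) :
    ∫ x, f (x + a) * g x = ∫ x, f x * g (x - a) := by
  rw [← integral_add_right_eq_self (fun x => f x * g (x - a)) a]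
  simp only [add_sub_cancel_right]

variable [FiniteDimensional ℝ F] [MeasureSpace F] [BorelSpace F]

theorem stronglyMeasurable_integral_line {f : F → ℝ} (hf : StronglyMeasurable f) (θ : F) :
    StronglyMeasurable fun p : F × ℝ => ∫ τ in (0 : ℝ)..p.2, f (p.1 + τ • θ) := by
  have rescale (p : F × ℝ) : ∫ τ in (0 : ℝ)..p.2, f (p.1 + τ • θ) =
      p.2 * ∫ σ in Ioc (0 : ℝ) 1, f (p.1 + (σ * p.2) • θ) := by
    rw [← intervalIntegral.integral_of_le zero_le_one,
      intervalIntegral.mul_integral_comp_mul_right (f := fun τ => f (p.1 + τ • θ)), zero_mul,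
      one_mul]
  simp_rw [rescale]
  have hf' : StronglyMeasurable fun z : (F × ℝ) × ℝ => f (z.1.1 + (z.2 * z.1.2) • θ) :=
    hf.comp_measurable (by fun_prop)
  exact measurable_snd.stronglyMeasurable.mul hf'.integral_prod_right'

variable [(volume : Measure F).IsAddHaarMeasure] {f g u w : F → ℝ} {θ : F}

theorem integrable_comp_add_smul (hf : Integrable f) (θ : F) (a b : ℝ) :
    Integrable (fun p : ℝ × F => f (p.2 + p.1 • θ))
      ((volume.restrict (uIoc a b)).prod (volume : Measure F)) := by
  have h : MeasurePreserving (fun p : ℝ × F => (p.1, p.2 + p.1 • θ))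
      ((volume.restrict (uIoc a b)).prod (volume : Measure F))
      ((volume.restrict (uIoc a b)).prod (volume : Measure F)) :=
    (MeasurePreserving.id _).skew_product (g := fun s x => x + s • θ) (by fun_prop)
      (Eventually.of_forall fun s => map_add_right_eq_self _ _)
  exact h.integrable_comp_of_integrable (hf.comp_snd _)

theorem integrable_integral_line (hf : Integrable f) (θ : F) (t : ℝ) :
    Integrable fun x => ∫ τ in (0 : ℝ)..t, f (x + τ • θ) := by
  simp_rw [intervalIntegral.intervalIntegral_eq_integral_uIoc]
  exact (integrable_comp_add_smul hf θ 0 t).integral_prod_right.smul (_ : ℝ)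

theorem integral_integral_line_mul (hf : Integrable f) (hg : Continuous g)
    (hgc : HasCompactSupport g) (t : ℝ) :
    ∫ x, (∫ τ in (0 : ℝ)..t, f (x + τ • θ)) * g x =
      ∫ τ in (0 : ℝ)..t, ∫ x, f (x + τ • θ) * g x := by
  obtain ⟨C, hC⟩ := hgc.exists_bound_of_continuous hg
  simp_rw [← intervalIntegral.integral_mul_const]
  exact (intervalIntegral_integral_swap ((integrable_comp_add_smul hf θ 0 t).mul_bdd
    (Continuous.aestronglyMeasurable (by fun_prop)) (Eventually.of_forall fun p => hC _))).symm

theorem integral_comp_add_smul_mul_sub (hf : Integrable f) (hφ : ContDiff ℝ 1 φ)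
    (hc : HasCompactSupport φ) (t : ℝ) :
    ∫ x, (f (x + t • θ) - f x) * φ x =
      -∫ τ in (0 : ℝ)..t, ∫ x, f x * fderiv ℝ φ (x - τ • θ) θ := by
  obtain ⟨C, hC⟩ := hc.exists_bound_of_continuous hφ.continuous
  have hdc : Continuous fun x => fderiv ℝ φ x θ :=
    (hφ.continuous_fderiv one_ne_zero).clm_apply continuous_const
  obtain ⟨C', hC'⟩ := (hc.fderiv_apply ℝ θ).exists_bound_of_continuous hdc
  have hint {v ψ : F → ℝ} (hv : Integrable v) (hψ : Continuous ψ) (hb : ∀ x, ‖ψ x‖ ≤ C) :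
      Integrable fun x => v x * ψ x :=
    hv.mul_bdd hψ.aestronglyMeasurable (Eventually.of_forall hb)
  calc ∫ x, (f (x + t • θ) - f x) * φ x
      = ∫ x, f x * (φ (x - t • θ) - φ x) := by
        simp_rw [sub_mul, mul_sub]
        rw [integral_sub (hint (hf.comp_add_right _) hφ.continuous hC) (hint hf hφ.continuous hC),
          integral_sub (hint hf (by fun_prop) fun x => hC _) (hint hf hφ.continuous hC),
          integral_comp_add_mul]
    _ = -∫ x, ∫ τ in (0 : ℝ)..t, f x * fderiv ℝ φ (x - τ • θ) θ := by
        simp_rw [sub_eq_neg_integral_fderiv hφ θ _ t, mul_neg, integral_neg,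
          intervalIntegral.integral_const_mul]
    _ = -∫ τ in (0 : ℝ)..t, ∫ x, f x * fderiv ℝ φ (x - τ • θ) θ := by
        rw [intervalIntegral_integral_swap]
        exact (hf.comp_snd _).mul_bdd (Continuous.aestronglyMeasurable (by fun_prop))
          (Eventually.of_forall fun p => hC' _)

theorem HasWeakDirDeriv.integral_comp_add_sub_mul (h : HasWeakDirDeriv Ω u w θ) (hΩ : IsOpen Ω)
    (hu : IntegrableOn u Ω) (hw : IntegrableOn w Ω) (hφ : ContDiff ℝ ∞ φ)
    (hc : HasCompactSupport φ) {t : ℝ} (hs : tsupport φ ⊆ {x | t ∈ chord Ω θ x}) :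
    ∫ x, (Ω.indicator u (x + t • θ) - Ω.indicator u x) * φ x =
      ∫ x, (∫ τ in (0 : ℝ)..t, Ω.indicator w (x + τ • θ)) * φ x := by
  have hu' : Integrable (Ω.indicator u) := (integrable_indicator_iff hΩ.measurableSet).2 hu
  have hw' : Integrable (Ω.indicator w) := (integrable_indicator_iff hΩ.measurableSet).2 hw
  have translate : ∀ τ ∈ uIcc 0 t, ∫ x, Ω.indicator u x * fderiv ℝ φ (x - τ • θ) θ =
      -∫ x, Ω.indicator w (x + τ • θ) * φ x := fun τ hτ => by
    have hτφ := h.integral_indicator_mul_fderiv hΩ.measurableSet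
      (isTestFunction_comp_sub hφ hc (a := τ • θ) fun x hx => hs hx τ hτ)
    simp_rw [fderiv_comp_sub] at hτφ
    rw [hτφ, integral_comp_add_mul]
  rw [integral_comp_add_smul_mul_sub hu' (hφ.of_le (by simp)) hc,
    integral_integral_line_mul hw' hφ.continuous hc, intervalIntegral.integral_congr translate,
    intervalIntegral.integral_neg, neg_neg]

theorem HasWeakDirDeriv.ae_eq_add_integral (h : HasWeakDirDeriv Ω u w θ) (hΩ : IsOpen Ω)
    (hu : IntegrableOn u Ω) (hw : IntegrableOn w Ω) (t : ℝ) :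
    ∀ᵐ x, t ∈ chord Ω θ x → u (x + t • θ) = u x + ∫ τ in (0 : ℝ)..t, w (x + τ • θ) := by
  have hu' : Integrable (Ω.indicator u) := (integrable_indicator_iff hΩ.measurableSet).2 hu
  have hw' : Integrable (Ω.indicator w) := (integrable_indicator_iff hΩ.measurableSet).2 hw
  have hdiff : Integrable fun x => Ω.indicator u (x + t • θ) - Ω.indicator u x :=
    (hu'.comp_add_right (t • θ)).sub hu'
  have hline := integrable_integral_line hw' θ t
  have vanish : ∀ᵐ x, x ∈ {x | t ∈ chord Ω θ x} → Ω.indicator u (x + t • θ) - Ω.indicator u x -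
      ∫ τ in (0 : ℝ)..t, Ω.indicator w (x + τ • θ) = 0 := by
    refine (isOpen_setOf_fixed_mem_chord hΩ θ t).ae_eq_zero_of_integral_contDiff_smul_eq_zero
      ((hdiff.sub hline).locallyIntegrable.locallyIntegrableOn _) fun φ hφ hc hs => ?_
    obtain ⟨C, hC⟩ := hc.exists_bound_of_continuous hφ.continuous
    have hint {v : F → ℝ} (hv : Integrable v) : Integrable fun x => v x * φ x :=
      hv.mul_bdd hφ.continuous.aestronglyMeasurable (Eventually.of_forall hC)
    calc _ = ∫ x, ((Ω.indicator u (x + t • θ) - Ω.indicator u x) * φ x -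
            (∫ τ in (0 : ℝ)..t, Ω.indicator w (x + τ • θ)) * φ x) := by
          simp_rw [smul_eq_mul, mul_comm (φ _), sub_mul]
      _ = 0 := by
          rw [integral_sub (hint hdiff) (hint hline),
            h.integral_comp_add_sub_mul hΩ hu hw hφ hc hs, sub_self]
  filter_upwards [vanish] with x hx ht
  have hw_eq : ∫ τ in (0 : ℝ)..t, Ω.indicator w (x + τ • θ) = ∫ τ in (0 : ℝ)..t, w (x + τ • θ) :=
    intervalIntegral.integral_congr fun τ hτ => indicator_of_mem (ht τ hτ) w
  have hx := hx ht
  rw [indicator_of_mem (add_smul_mem_of_mem_chord ht), indicator_of_mem (mem_of_mem_chord ht),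
    hw_eq] at hx
  linarith

theorem HasWeakDirDeriv.ae_ae_eq_add_integral (h : HasWeakDirDeriv Ω u w θ) (hΩ : IsOpen Ω)
    (hum : StronglyMeasurable u) (hwm : StronglyMeasurable w)
    (hu : IntegrableOn u Ω) (hw : IntegrableOn w Ω) :
    ∀ᵐ x, ∀ᵐ t : ℝ, t ∈ chord Ω θ x →
      u (x + t • θ) = u x + ∫ τ in (0 : ℝ)..t, w (x + τ • θ) := by
  rw [Measure.ae_ae_comm]
  · exact Eventually.of_forall fun t => h.ae_eq_add_integral hΩ hu hw t
  · refine (isOpen_setOf_mem_chord hΩ θ).measurableSet.imp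
      (StronglyMeasurable.measurableSet_eq_fun (hum.comp_measurable (by fun_prop)) ?_)
    exact (hum.comp_measurable measurable_fst).add (stronglyMeasurable_integral_line hwm θ)

end ACL

/-! ### Boundary values along chords -/

section ExitTime

variable {F : Type*} [NormedAddCommGroup F] [NormedSpace ℝ F] {Ω : Set F} {θ x : F}

theorem isOpen_setOf_forall_add_smul_mem (hΩ : IsOpen Ω) (θ : F) {K : Set ℝ} (hK : IsCompact K) :
    IsOpen {x | ∀ t ∈ K, x + t • θ ∈ Ω} := by
  rw [isOpen_iff_eventually]
  intro x hx
  refine hK.eventually_forall_of_forall_eventually fun t ht => ?_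
  have hc : Continuous fun p : F × ℝ => p.1 + p.2 • θ := by fun_prop
  exact hc.continuousAt.eventually_mem (hΩ.mem_nhds (hx t ht))

theorem lt_exitTime_iff (hb : Bornology.IsBounded Ω) (hθ : θ ≠ 0) {c : ℝ} (hc : 0 ≤ c) :
    c < exitTime Ω θ x ↔
      ∃ n : ℕ, ∀ k : ℕ, ∀ t ∈ Icc (1 / ((k : ℝ) + 1)) (c + 1 / ((n : ℝ) + 1)), x + t • θ ∈ Ω := by
  constructor
  · intro h
    obtain ⟨s, hs, hcs⟩ := exists_lt_of_lt_csSup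
      (s := {s : ℝ | 0 ≤ s ∧ ∀ t ∈ Ioo 0 s, x + t • θ ∈ Ω}) ⟨0, le_rfl, by simp⟩ h
    obtain ⟨n, hn⟩ := exists_nat_one_div_lt (sub_pos.2 hcs)
    exact ⟨n, fun k t ht => hs.2 t ⟨(by positivity : (0 : ℝ) < 1 / (k + 1)).trans_le ht.1,
      ht.2.trans_lt (by linarith)⟩⟩
  · rintro ⟨n, hn⟩
    have hpos : (0 : ℝ) < 1 / ((n : ℝ) + 1) := by positivity
    refine (lt_add_of_pos_right c hpos).trans_le
      (le_csSup (bddAbove_setOf_forall_Ioo_mem hb hθ x) ⟨by positivity, fun t ht => ?_⟩)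
    obtain ⟨k, hk⟩ := exists_nat_one_div_lt ht.1
    exact hn k t ⟨hk.le, ht.2.le⟩

theorem measurable_exitTime [MeasurableSpace F] [BorelSpace F] (hΩ : IsOpen Ω)
    (hb : Bornology.IsBounded Ω) (hθ : θ ≠ 0) : Measurable (exitTime Ω θ) := by
  refine measurable_of_Ioi fun c => ?_
  rcases lt_or_ge c 0 with hc | hc
  · convert MeasurableSet.univ
    exact eq_univ_of_forall fun x => hc.trans_le (Real.sSup_nonneg fun s hs => hs.1)
  · simp_rw [preimage, mem_Ioi, lt_exitTime_iff hb hθ hc, ofPred_exists, ofPred_forall (ι := ℕ)]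
    exact .iUnion fun n => .iInter fun k =>
      (isOpen_setOf_forall_add_smul_mem hΩ θ isCompact_Icc).measurableSet

end ExitTime

section EndVal

variable {F : Type*} [NormedAddCommGroup F] [NormedSpace ℝ F] {Ω : Set F} {θ x : F}
  {u w u' w' : F → ℝ}

/-- The value at the exit point `Φ_θ(x)` of the primitive of `w` along the chord of `x` that takes
the value `u x` at `x`: the candidate for the directional trace of `u` at `Φ_θ(x)`, where `w` is
the derivative of `u` along `θ`. -/
def endVal (Ω : Set F) (θ : F) (u w : F → ℝ) (x : F) : ℝ :=
  u x + ∫ τ in (0 : ℝ)..exitTime Ω θ x, w (x + τ • θ)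

/-- `x` is a regular point of `u`: along the chord of `x`, the function `u` agrees a.e. with a
primitive of the integrable function `w`, and this primitive takes the value `u x` at `x`. -/
structure IsRegularAt (Ω : Set F) (θ : F) (u w : F → ℝ) (x : F) : Prop where
  integrableOn : IntegrableOn (fun t : ℝ => w (x + t • θ)) (chord Ω θ x)
  ae_eq : ∀ᵐ t : ℝ, t ∈ chord Ω θ x → u (x + t • θ) = u x + ∫ τ in (0 : ℝ)..t, w (x + τ • θ)

theorem endVal_neg (Ω : Set F) (θ : F) (u w : F → ℝ) (x : F) :
    endVal Ω (-θ) u (-w) x =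
      u x + ∫ τ in (0 : ℝ)..(-exitTime Ω (-θ) x), w (x + τ • θ) := by
  have h := intervalIntegral.integral_comp_neg (a := 0) (b := exitTime Ω (-θ) x)
    (fun τ : ℝ => w (x + τ • θ))
  simp only [endVal, Pi.neg_apply, smul_neg, neg_smul] at h ⊢
  rw [intervalIntegral.integral_neg, h, neg_zero, intervalIntegral.integral_symm, neg_neg]

theorem zero_mem_uIcc_exitTime (hΩ : IsOpen Ω) (hb : Bornology.IsBounded Ω) (hθ : θ ≠ 0)
    (hx : x ∈ Ω) : (0 : ℝ) ∈ uIcc (-exitTime Ω (-θ) x) (exitTime Ω θ x) :=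
  mem_uIcc_of_le (neg_nonpos.2 (exitTime_pos hΩ hb (neg_ne_zero.2 hθ) hx).le)
    (exitTime_pos hΩ hb hθ hx).le

theorem intervalIntegrable_of_integrableOn_chord (hΩ : IsOpen Ω) (hb : Bornology.IsBounded Ω)
    (hθ : θ ≠ 0) (hx : x ∈ Ω) {f : ℝ → ℝ} (hf : IntegrableOn f (chord Ω θ x)) :
    IntervalIntegrable f volume (-exitTime Ω (-θ) x) (exitTime Ω θ x) := by
  have h0 := exitTime_pos hΩ hb hθ hx
  have h0' := exitTime_pos hΩ hb (neg_ne_zero.2 hθ) hx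
  rwa [intervalIntegrable_iff_integrableOn_Ioo_of_le (by linarith), ← chord_eq_Ioo hΩ hb hθ hx]

theorem endVal_sub (hΩ : IsOpen Ω) (hb : Bornology.IsBounded Ω) (hθ : θ ≠ 0) (hx : x ∈ Ω)
    (hw : IntegrableOn (fun t => w (x + t • θ)) (chord Ω θ x))
    (hw' : IntegrableOn (fun t => w' (x + t • θ)) (chord Ω θ x)) :
    endVal Ω θ (u - u') (w - w') x = endVal Ω θ u w x - endVal Ω θ u' w' x := by
  have hsub := uIcc_subset_uIcc_right (zero_mem_uIcc_exitTime hΩ hb hθ hx)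
  have h := (intervalIntegrable_of_integrableOn_chord hΩ hb hθ hx hw).mono_set hsub
  have h' := (intervalIntegrable_of_integrableOn_chord hΩ hb hθ hx hw').mono_set hsub
  simp only [endVal, Pi.sub_apply]
  rw [intervalIntegral.integral_sub h h']
  ring

theorem integral_primitive_mul_add {p q : ℝ → ℝ} {a b c : ℝ} (hc : c ∈ uIcc a b)
    (hp : IntervalIntegrable p volume a b) (hq : IntervalIntegrable q volume a b) (A B : ℝ) :
    ∫ t in a..b, ((A + ∫ τ in c..t, p τ) * q t + (B + ∫ τ in c..t, q τ) * p t) =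
      (A + ∫ τ in c..b, p τ) * (B + ∫ τ in c..b, q τ) -
      (A + ∫ τ in c..a, p τ) * (B + ∫ τ in c..a, q τ) := by
  have hconst (C : ℝ) : AbsolutelyContinuousOnInterval (fun _ : ℝ => C) a b :=
    (LipschitzWith.const C).lipschitzOnWith.absolutelyContinuousOnInterval
  have hP := (hconst A).add (hp.absolutelyContinuousOnInterval_intervalIntegral hc)
  have hQ := (hconst B).add (hq.absolutelyContinuousOnInterval_intervalIntegral hc)
  refine Eq.trans (intervalIntegral.integral_congr_ae ?_) (hP.integral_deriv_mul_eq_sub hQ)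
  filter_upwards [hp.ae_hasDerivAt_integral, hq.ae_hasDerivAt_integral] with t hpt hqt ht
  have ht' := uIoc_subset_uIcc ht
  rw [((hasDerivAt_const t A).add (hpt ht' c hc)).deriv,
    ((hasDerivAt_const t B).add (hqt ht' c hc)).deriv]
  simp only [Pi.add_apply]
  ring

theorem IsRegularAt.integral_chord_mul_add (h : IsRegularAt Ω θ u w x)
    (h' : IsRegularAt Ω θ u' w' x) (hΩ : IsOpen Ω) (hb : Bornology.IsBounded Ω) (hθ : θ ≠ 0)
    (hx : x ∈ Ω) :
    ∫ t in chord Ω θ x, (u (x + t • θ) * w' (x + t • θ) + u' (x + t • θ) * w (x + t • θ)) =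
      endVal Ω θ u w x * endVal Ω θ u' w' x -
      endVal Ω (-θ) u (-w) x * endVal Ω (-θ) u' (-w') x := by
  have h0 := exitTime_pos hΩ hb hθ hx
  have h0' := exitTime_pos hΩ hb (neg_ne_zero.2 hθ) hx
  rw [endVal_neg, endVal_neg, endVal, endVal,
    ← integral_primitive_mul_add (zero_mem_uIcc_exitTime hΩ hb hθ hx)
      (intervalIntegrable_of_integrableOn_chord hΩ hb hθ hx h.integrableOn)
      (intervalIntegrable_of_integrableOn_chord hΩ hb hθ hx h'.integrableOn),
    intervalIntegral.integral_of_le (by linarith), integral_Ioc_eq_integral_Ioo,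
    ← chord_eq_Ioo hΩ hb hθ hx]
  refine setIntegral_congr_ae (isOpen_chord hΩ θ x).measurableSet ?_
  filter_upwards [h.ae_eq, h'.ae_eq] with t hu hu' ht
  rw [hu ht, hu' ht]

end EndVal

section IsTestFunction

variable {F : Type*} [NormedAddCommGroup F] [InnerProductSpace ℝ F] {Ω : Set F} {θ x : F}
  {φ : F → ℝ}

theorem isRegularAt_of_contDiff (hb : Bornology.IsBounded Ω) (hθ : θ ≠ 0)
    (hφ : ContDiff ℝ 1 φ) (x : F) : IsRegularAt Ω θ φ (fun x => fderiv ℝ φ x θ) x := by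
  have : Continuous fun x => fderiv ℝ φ x θ :=
    (hφ.continuous_fderiv one_ne_zero).clm_apply continuous_const
  refine ⟨?_, Eventually.of_forall fun t _ => ?_⟩
  · have hct : Continuous fun t : ℝ => fderiv ℝ φ (x + t • θ) θ := by fun_prop
    exact (hct.locallyIntegrable.integrableOn_isCompact
      (isBounded_chord hb hθ x).isCompact_closure).mono_set subset_closure
  · rw [integral_fderiv_line hφ, add_sub_cancel]

theorem IsTestFunction.endVal_eq_zero (hφ : IsTestFunction Ω φ) (hΩ : IsOpen Ω)
    (hb : Bornology.IsBounded Ω) (hθ : θ ≠ 0) (hx : x ∈ Ω) :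
    endVal Ω θ φ (fun x => fderiv ℝ φ x θ) x = 0 := by
  rw [endVal, integral_fderiv_line (hφ.1.of_le (by simp)), add_sub_cancel]
  exact image_eq_zero_of_notMem_tsupport fun h => add_exitTime_smul_notMem hΩ hb hθ hx (hφ.2.2 h)

end IsTestFunction

section BoundaryValueL2

open ProbabilityTheory

variable {F : Type*} [NormedAddCommGroup F] [InnerProductSpace ℝ F] [MeasureSpace F] [BorelSpace F]
  {Ω : Set F} {θ : F} {u w u' w' : F → ℝ}

theorem enorm_integral_exitTime_le (hΩ : IsOpen Ω) (hb : Bornology.IsBounded Ω) (hθ : ‖θ‖ = 1)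
    {x : F} (hx : x ∈ Ω) (w : F → ℝ) :
    ‖∫ τ in (0 : ℝ)..exitTime Ω θ x, w (x + τ • θ)‖ₑ ≤
      Metric.ediam Ω * ∫⁻ t, ‖w (x + t • θ)‖ₑ ∂(chordKernel hΩ θ x) := by
  have hθ0 : θ ≠ 0 := norm_ne_zero_iff.1 (by simp [hθ])
  have hsub : Ioo 0 (exitTime Ω θ x) ⊆ chord Ω θ x := fun t ht =>
    (mem_chord_iff_lt_exitTime hΩ hb hθ0 hx ht.1.le).2 ht.2
  calc ‖∫ τ in (0 : ℝ)..exitTime Ω θ x, w (x + τ • θ)‖ₑ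
      = ‖∫ τ in Ioo 0 (exitTime Ω θ x), w (x + τ • θ)‖ₑ := by
        rw [intervalIntegral.integral_of_le (exitTime_pos hΩ hb hθ0 hx).le,
          integral_Ioc_eq_integral_Ioo]
    _ ≤ ∫⁻ t in chord Ω θ x, ‖w (x + t • θ)‖ₑ :=
        (enorm_integral_le_lintegral_enorm _).trans (lintegral_mono_set hsub)
    _ = volume (chord Ω θ x) * ∫⁻ t, ‖w (x + t • θ)‖ₑ ∂(chordKernel hΩ θ x) := by
        rw [restrict_chord_eq_smul_chordKernel hΩ hb hθ0 hx, lintegral_smul_measure, smul_eq_mul]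
    _ ≤ _ := by
        gcongr
        exact volume_chord_le_ediam hθ Ω x

variable [FiniteDimensional ℝ F]

theorem stronglyMeasurable_integral_exitTime (hΩ : IsOpen Ω) (hb : Bornology.IsBounded Ω)
    (hθ : θ ≠ 0) (hw : StronglyMeasurable w) :
    StronglyMeasurable fun x => ∫ τ in (0 : ℝ)..exitTime Ω θ x, w (x + τ • θ) :=
  (stronglyMeasurable_integral_line hw θ).comp_measurable
    (measurable_id.prodMk (measurable_exitTime hΩ hb hθ))

theorem stronglyMeasurable_endVal (hΩ : IsOpen Ω) (hb : Bornology.IsBounded Ω)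
    (hθ : θ ≠ 0) (hu : StronglyMeasurable u) (hw : StronglyMeasurable w) :
    StronglyMeasurable (endVal Ω θ u w) :=
  hu.add (stronglyMeasurable_integral_exitTime hΩ hb hθ hw)

variable [(volume : Measure F).IsAddHaarMeasure]

theorem eLpNorm_lintegral_chordKernel_le (hΩ : IsOpen Ω) (hb : Bornology.IsBounded Ω)
    (hθ : θ ≠ 0) {p : ℝ≥0∞} (hp1 : 1 ≤ p) (hp : p ≠ ⊤) {f : F → ℝ} (hf : StronglyMeasurable f) :
    eLpNorm (fun x => ∫⁻ t, ‖f (x + t • θ)‖ₑ ∂(chordKernel hΩ θ x)) p (volume.restrict Ω) ≤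
      eLpNorm f p (volume.restrict Ω) := by
  have hp0 : p ≠ 0 := (one_pos.trans_le hp1).ne'
  have hf' : Measurable fun x => ‖f x‖ₑ ^ p.toReal := hf.enorm.pow_const _
  have jensen (x : F) (hx : x ∈ Ω) : (∫⁻ t, ‖f (x + t • θ)‖ₑ ∂(chordKernel hΩ θ x)) ^ p.toReal ≤
      ∫⁻ t, ‖f (x + t • θ)‖ₑ ^ p.toReal ∂(chordKernel hΩ θ x) := by
    have := isProbabilityMeasure_chordKernel hΩ hb hθ hx
    have h := eLpNorm_le_eLpNorm_of_exponent_le (μ := chordKernel hΩ θ x) hp1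
      (hf.comp_measurable (by fun_prop : Measurable fun t : ℝ => x + t • θ)).aestronglyMeasurable
    rwa [eLpNorm_one_eq_lintegral_enorm, eLpNorm_eq_lintegral_rpow_enorm_toReal hp0 hp, one_div,
      ENNReal.le_rpow_inv_iff (ENNReal.toReal_pos hp0 hp)] at h
  rw [eLpNorm_eq_lintegral_rpow_enorm_toReal hp0 hp, eLpNorm_eq_lintegral_rpow_enorm_toReal hp0 hp]
  gcongr ?_ ^ _
  calc ∫⁻ x in Ω, ‖∫⁻ t, ‖f (x + t • θ)‖ₑ ∂(chordKernel hΩ θ x)‖ₑ ^ p.toReal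
      ≤ ∫⁻ x in Ω, ∫⁻ t, ‖f (x + t • θ)‖ₑ ^ p.toReal ∂(chordKernel hΩ θ x) :=
        setLIntegral_mono' hΩ.measurableSet jensen
    _ = ∫⁻ q, ‖f (q.1 + q.2 • θ)‖ₑ ^ p.toReal ∂((volume.restrict Ω) ⊗ₘ chordKernel hΩ θ) :=
        (Measure.lintegral_compProd (f := fun q => ‖f (q.1 + q.2 • θ)‖ₑ ^ p.toReal)
          (hf'.comp (by fun_prop))).symm
    _ = ∫⁻ x in Ω, ‖f x‖ₑ ^ p.toReal :=
        (measurePreserving_add_smul hΩ hb hθ).lintegral_comp hf'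

theorem eLpNorm_integral_exitTime_le (hΩ : IsOpen Ω) (hb : Bornology.IsBounded Ω)
    (hθ : ‖θ‖ = 1) {p : ℝ≥0∞} (hp1 : 1 ≤ p) (hp : p ≠ ⊤) (hw : StronglyMeasurable w) :
    eLpNorm (fun x => ∫ τ in (0 : ℝ)..exitTime Ω θ x, w (x + τ • θ)) p (volume.restrict Ω) ≤
      Metric.ediam Ω * eLpNorm w p (volume.restrict Ω) := by
  have hθ0 : θ ≠ 0 := norm_ne_zero_iff.1 (by simp [hθ])
  have hmeas : Measurable fun x => ∫⁻ t, ‖w (x + t • θ)‖ₑ ∂(chordKernel hΩ θ x) :=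
    (hw.enorm.comp
      (by fun_prop : Measurable fun q : F × ℝ => q.1 + q.2 • θ)).lintegral_kernel_prod_right'
  refine (eLpNorm_le_mul_eLpNorm_of_ae_le_mul'' p hmeas.aestronglyMeasurable
    (ae_restrict_of_forall_mem hΩ.measurableSet fun x hx =>
      enorm_integral_exitTime_le hΩ hb hθ hx w)).trans ?_
  gcongr
  exact eLpNorm_lintegral_chordKernel_le hΩ hb hθ0 hp1 hp hw

theorem eLpNorm_endVal_le (hΩ : IsOpen Ω) (hb : Bornology.IsBounded Ω) (hθ : ‖θ‖ = 1)
    {p : ℝ≥0∞} (hp1 : 1 ≤ p) (hp : p ≠ ⊤) (hu : StronglyMeasurable u)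
    (hw : StronglyMeasurable w) :
    eLpNorm (endVal Ω θ u w) p (volume.restrict Ω) ≤
      eLpNorm u p (volume.restrict Ω) + Metric.ediam Ω * eLpNorm w p (volume.restrict Ω) := by
  have hθ0 : θ ≠ 0 := norm_ne_zero_iff.1 (by simp [hθ])
  refine (eLpNorm_add_le hu.aestronglyMeasurable
    (stronglyMeasurable_integral_exitTime hΩ hb hθ0 hw).aestronglyMeasurable hp1).trans ?_
  gcongr
  exact eLpNorm_integral_exitTime_le hΩ hb hθ hp1 hp hw

theorem endVal_sub_ae_eq (hΩ : IsOpen Ω) (hb : Bornology.IsBounded Ω) (hθ : θ ≠ 0)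
    (hw : IntegrableOn w Ω) (hw' : IntegrableOn w' Ω) :
    endVal Ω θ (u - u') (w - w') =ᵐ[volume.restrict Ω] endVal Ω θ u w - endVal Ω θ u' w' := by
  filter_upwards [ae_integrableOn_chord hΩ hb hθ hw, ae_integrableOn_chord hΩ hb hθ hw',
    ae_restrict_mem hΩ.measurableSet] with x hxw hxw' hx
  exact endVal_sub hΩ hb hθ hx hxw hxw'

theorem HasWeakDirDeriv.ae_isRegularAt (h : HasWeakDirDeriv Ω u w θ) (hΩ : IsOpen Ω)
    (hb : Bornology.IsBounded Ω) (hθ : θ ≠ 0) (hum : StronglyMeasurable u)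
    (hwm : StronglyMeasurable w) (hu : IntegrableOn u Ω) (hw : IntegrableOn w Ω) :
    ∀ᵐ x ∂volume.restrict Ω, IsRegularAt Ω θ u w x := by
  filter_upwards [ae_integrableOn_chord hΩ hb hθ hw,
    ae_restrict_of_ae (h.ae_ae_eq_add_integral hΩ hum hwm hu hw)] with x hxw hxu
  exact ⟨hxw, hxu⟩

theorem integral_mul_add_of_ae_isRegularAt (hΩ : IsOpen Ω) (hb : Bornology.IsBounded Ω)
    (hθ : θ ≠ 0) (h : ∀ᵐ x ∂volume.restrict Ω, IsRegularAt Ω θ u w x)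
    (h' : ∀ᵐ x ∂volume.restrict Ω, IsRegularAt Ω θ u' w' x)
    (hint : IntegrableOn (fun x => u x * w' x + u' x * w x) Ω) :
    IntegrableOn (fun x => (volume (chord Ω θ x)).toReal⁻¹ *
        (endVal Ω θ u w x * endVal Ω θ u' w' x -
          endVal Ω (-θ) u (-w) x * endVal Ω (-θ) u' (-w') x)) Ω ∧
      ∫ x in Ω, (u x * w' x + u' x * w x) = ∫ x in Ω, (volume (chord Ω θ x)).toReal⁻¹ *
        (endVal Ω θ u w x * endVal Ω θ u' w' x -
          endVal Ω (-θ) u (-w) x * endVal Ω (-θ) u' (-w') x) := by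
  have parts : (fun x => ∫ t, (u (x + t • θ) * w' (x + t • θ) + u' (x + t • θ) * w (x + t • θ))
      ∂(chordKernel hΩ θ x)) =ᵐ[volume.restrict Ω] fun x => (volume (chord Ω θ x)).toReal⁻¹ *
        (endVal Ω θ u w x * endVal Ω θ u' w' x -
          endVal Ω (-θ) u (-w) x * endVal Ω (-θ) u' (-w') x) := by
    filter_upwards [h, h', ae_restrict_mem hΩ.measurableSet] with x hx hx' hxΩ
    rw [integral_chordKernel, hx.integral_chord_mul_add hx' hΩ hb hθ hxΩ]
  exact ⟨(integrable_integral_chordKernel hΩ hb hθ hint).congr parts,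
    (integral_integral_chordKernel hΩ hb hθ hint).symm.trans (integral_congr_ae parts)⟩

theorem hasWeakDirDeriv_of_ae_isRegularAt (hΩ : IsOpen Ω) (hb : Bornology.IsBounded Ω)
    (hθ : θ ≠ 0) (hu : MemLp u 2 (volume.restrict Ω)) (hw : MemLp w 2 (volume.restrict Ω))
    (h : ∀ᵐ x ∂volume.restrict Ω, IsRegularAt Ω θ u w x) : HasWeakDirDeriv Ω u w θ := by
  intro φ hφ
  have hu' : IntegrableOn (fun x => u x * fderiv ℝ φ x θ) Ω := hu.integrable_mul (hφ.memLp_fderiv θ)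
  have hw' : IntegrableOn (fun x => φ x * w x) Ω := hφ.memLp.integrable_mul hw
  have hparts := (integral_mul_add_of_ae_isRegularAt hΩ hb hθ h
    (ae_of_all _ (isRegularAt_of_contDiff hb hθ (hφ.1.of_le (by simp)))) (hu'.add hw')).2
  have hneg : (-fun x => fderiv ℝ φ x θ) = fun x => fderiv ℝ φ x (-θ) := by ext x; simp
  have hzero : ∀ x ∈ Ω, (volume (chord Ω θ x)).toReal⁻¹ *
      (endVal Ω θ u w x * endVal Ω θ φ (fun x => fderiv ℝ φ x θ) x -
        endVal Ω (-θ) u (-w) x * endVal Ω (-θ) φ (-fun x => fderiv ℝ φ x θ) x) = 0 := fun x hx => by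
    rw [hφ.endVal_eq_zero hΩ hb hθ hx, hneg, hφ.endVal_eq_zero hΩ hb (neg_ne_zero.2 hθ) hx]
    ring
  rw [setIntegral_eq_zero_of_forall_eq_zero hzero, integral_add hu' hw'] at hparts
  simp_rw [mul_comm (w _)]
  exact eq_neg_of_add_eq_zero_left hparts

end BoundaryValueL2

/-! ### Slicing by the lines parallel to `θ` -/

section Slicing

variable {d : ℕ} {θ : Eu d}

theorem hypMeasure_eq_volume (θ : Eu d) : hypMeasure θ = volume :=
  (stdOrthonormalBasis ℝ (Hyp θ)).addHaar_eq_volume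

theorem inner_smul_add_orthogonalProjectionOnto (hθ : ‖θ‖ = 1) (x : Eu d) :
    inner ℝ θ x • θ + ((Hyp θ).orthogonalProjectionOnto x : Eu d) = x := by
  have h := Submodule.starProjection_add_starProjection_orthogonal
    (K := Submodule.span ℝ {θ}) x
  rwa [Submodule.starProjection_unit_singleton ℝ hθ] at h

theorem measurePreserving_smul_add (hθ : ‖θ‖ = 1) :
    MeasurePreserving (fun p : Hyp θ × ℝ => p.2 • θ + (p.1 : Eu d))
      ((hypMeasure θ).prod volume) volume := by
  rw [hypMeasure_eq_volume]
  have hspan := (LinearIsometryEquiv.toSpanUnitSingleton (𝕜 := ℝ) θ hθ).measurePreserving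
  exact ((Submodule.span ℝ {θ}).orthogonalDecomposition.symm.measurePreserving.comp
    (WithLp.volume_preserving_toLp _ _)).comp
    ((hspan.prod (.id volume)).comp Measure.measurePreserving_swap)

theorem ae_ae_smul_add (hθ : ‖θ‖ = 1) {p : Eu d → Prop} (hp : ∀ᵐ x, p x) :
    ∀ᵐ y : Hyp θ ∂hypMeasure θ, ∀ᵐ s : ℝ, p (s • θ + (y : Eu d)) := by
  have h := (measurePreserving_smul_add hθ).quasiMeasurePreserving.ae hp
  rw [hypMeasure_eq_volume] at h ⊢
  exact Measure.ae_ae_of_ae_prod h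

theorem quasiMeasurePreserving_orthogonalProjectionOnto (θ : Eu d) :
    Measure.QuasiMeasurePreserving (Hyp θ).orthogonalProjectionOnto volume (hypMeasure θ) := by
  rw [hypMeasure_eq_volume]
  have h : Measure.QuasiMeasurePreserving
      (fun x => ((Submodule.span ℝ {θ}).orthogonalDecomposition x).snd) volume volume :=
    Measure.quasiMeasurePreserving_snd.comp ((WithLp.volume_preserving_ofLp _ _).comp
      (Submodule.span ℝ {θ}).orthogonalDecomposition.measurePreserving).quasiMeasurePreserving
  simpa only [Submodule.snd_orthogonalDecomposition_apply] using h

theorem isOpen_lineSection {Ω : Set (Eu d)} (hΩ : IsOpen Ω) (θ y : Eu d) :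
    IsOpen (lineSection Ω θ y) :=
  hΩ.preimage (by fun_prop : Continuous fun s : ℝ => s • θ + y)

theorem ae_integrableOn_lineSection {Ω : Set (Eu d)} (hΩ : IsOpen Ω) (hθ : ‖θ‖ = 1)
    {f : Eu d → ℝ} (hf : IntegrableOn f Ω) :
    ∀ᵐ y : Hyp θ ∂hypMeasure θ,
      IntegrableOn (fun s : ℝ => f (s • θ + (y : Eu d))) (lineSection Ω θ y) := by
  have h := (measurePreserving_smul_add hθ).integrable_comp_of_integrable
    ((integrable_indicator_iff hΩ.measurableSet).2 hf)
  rw [hypMeasure_eq_volume] at h ⊢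
  filter_upwards [h.prod_right_ae] with y hy
  exact (integrable_indicator_iff (isOpen_lineSection hΩ θ y).measurableSet).1 hy

theorem ae_memLp_lineSection {Ω : Set (Eu d)} (hΩ : IsOpen Ω) (hθ : ‖θ‖ = 1)
    {f : Eu d → ℝ} (hfm : StronglyMeasurable f) (hf : MemLp f 2 (volume.restrict Ω)) :
    ∀ᵐ y : Hyp θ ∂hypMeasure θ, MemLp (fun s : ℝ => f (s • θ + (y : Eu d))) 2
      (volume.restrict (lineSection Ω θ y)) := by
  filter_upwards [ae_integrableOn_lineSection hΩ hθ hf.integrable_sq] with y hy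
  exact (memLp_two_iff_integrable_sq
    (hfm.comp_measurable (by fun_prop)).aestronglyMeasurable).2 hy

end Slicing

/-! ### Directional traces as boundary values along chords -/

section ComponentInterval

variable {J : Set ℝ} {α β s c : ℝ} {u w : ℝ → ℝ}

theorem isComponentInterval_exitTime (hJ : IsOpen J) (hb : Bornology.IsBounded J) (hs : s ∈ J) :
    IsComponentInterval J (s - exitTime J (-1) s) (s + exitTime J 1 s) := by
  have hpos := exitTime_pos hJ hb one_ne_zero hs
  have hneg := exitTime_pos hJ hb (neg_ne_zero.2 one_ne_zero) hs
  refine ⟨by linarith, fun t ht => ?_, ?_, ?_⟩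
  · have hmem : t - s ∈ chord J 1 s := by
      rw [chord_eq_Ioo hJ hb one_ne_zero hs]
      exact ⟨by linarith [ht.1], by linarith [ht.2]⟩
    simpa using add_smul_mem_of_mem_chord hmem
  · simpa [sub_eq_add_neg] using add_exitTime_smul_notMem hJ hb (neg_ne_zero.2 one_ne_zero) hs
  · simpa using add_exitTime_smul_notMem hJ hb one_ne_zero hs

theorem IsComponentInterval.exitTime_one (h : IsComponentInterval J α β) (hs : s ∈ Ioo α β) :
    exitTime J 1 s = β - s :=
  exitTime_eq (sub_pos.2 hs.2)
    (fun t ht => h.2.1 ⟨by simpa using hs.1.trans (lt_add_of_pos_right s ht.1),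
      by simpa using lt_sub_iff_add_lt'.1 ht.2⟩)
    (by simpa using h.2.2.2)

theorem IsComponentInterval.exitTime_neg_one (h : IsComponentInterval J α β)
    (hs : s ∈ Ioo α β) : exitTime J (-1) s = s - α :=
  exitTime_eq (sub_pos.2 hs.1)
    (fun t ht => h.2.1 ⟨by simpa using lt_sub_iff_add_lt'.1 ht.2,
      by simpa using hs.2.trans (lt_add_of_pos_right β ht.1)⟩)
    (by simpa using h.2.2.1)

theorem IsComponentInterval.chord_one (h : IsComponentInterval J α β) (hJ : IsOpen J)
    (hb : Bornology.IsBounded J) (hs : s ∈ Ioo α β) : chord J 1 s = Ioo (α - s) (β - s) := by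
  rw [chord_eq_Ioo hJ hb one_ne_zero (h.2.1 hs), h.exitTime_one hs, h.exitTime_neg_one hs, neg_sub]

theorem IsRegularAt.continuousOn_primitive (hu : IsRegularAt J 1 u w s)
    (h : IsComponentInterval J α β) (hJ : IsOpen J) (hb : Bornology.IsBounded J)
    (hs : s ∈ Ioo α β) : ContinuousOn (fun t => u s + ∫ τ in s..t, w τ) (Icc α β) := by
  have hw := intervalIntegrable_of_integrableOn_chord hJ hb one_ne_zero (h.2.1 hs) hu.integrableOn
  rw [h.exitTime_one hs, h.exitTime_neg_one hs, neg_sub] at hw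
  have hw' : IntervalIntegrable w volume α β := by simpa using hw.comp_sub_right s
  rw [← uIcc_of_le h.1.le]
  exact continuousOn_const.add (intervalIntegral.continuousOn_primitive_interval' hw'
    (mem_uIcc_of_le hs.1.le hs.2.le))

theorem IsRegularAt.ae_eq_primitive (hu : IsRegularAt J 1 u w s)
    (h : IsComponentInterval J α β) (hJ : IsOpen J) (hb : Bornology.IsBounded J)
    (hs : s ∈ Ioo α β) :
    (fun t => u s + ∫ τ in s..t, w τ) =ᵐ[volume.restrict (Ioo α β)] u := by
  have hae := (measurePreserving_sub_right volume s).quasiMeasurePreserving.ae hu.ae_eq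
  filter_upwards [ae_restrict_of_ae hae, ae_restrict_mem measurableSet_Ioo] with t ht hmem
  have hmem' : t - s ∈ chord J 1 s := by
    rw [h.chord_one hJ hb hs]
    exact ⟨sub_lt_sub_right hmem.1 s, sub_lt_sub_right hmem.2 s⟩
  simpa using (ht hmem').symm

theorem IsRegularAt.eq_endVal_iff (hu : IsRegularAt J 1 u w s)
    (h : IsComponentInterval J α β) (hJ : IsOpen J) (hb : Bornology.IsBounded J)
    (hs : s ∈ Ioo α β) :
    c = endVal J 1 u w s ↔ ∃ f : ℝ → ℝ, ContinuousOn f (Ioc α β) ∧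
      f =ᵐ[volume.restrict (Ioo α β)] u ∧ c = f β := by
  have hval : endVal J 1 u w s = u s + ∫ τ in s..β, w τ := by
    simp [endVal, h.exitTime_one hs]
  have hcont := (hu.continuousOn_primitive h hJ hb hs).mono Ioc_subset_Icc_self
  have hae := hu.ae_eq_primitive h hJ hb hs
  rw [hval]
  refine ⟨fun hc => ⟨_, hcont, hae, hc⟩, ?_⟩
  rintro ⟨f, hf, hfu, rfl⟩
  have hf_ae := hfu.trans hae.symm
  rw [restrict_Ioo_eq_restrict_Ioc] at hf_ae
  exact Measure.eqOn_Ioc_of_ae_eq volume hf_ae hf hcont (right_mem_Ioc.2 h.1)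

end ComponentInterval

section LineSection

variable {d : ℕ} {Ω : Set (Eu d)} {θ x y : Eu d} {u w : Eu d → ℝ}

theorem add_smul_mem_lineSection_iff (Ω : Set (Eu d)) (θ y : Eu d) (s t c : ℝ) :
    s + t • c ∈ lineSection Ω θ y ↔ s • θ + y + t • c • θ ∈ Ω := by
  rw [lineSection, mem_ofPred_eq, add_smul, smul_assoc, add_right_comm]

theorem chord_lineSection (Ω : Set (Eu d)) (θ y : Eu d) (s : ℝ) :
    chord (lineSection Ω θ y) 1 s = chord Ω θ (s • θ + y) := by
  simp only [chord, add_smul_mem_lineSection_iff, one_smul]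

theorem exitTime_lineSection (Ω : Set (Eu d)) (θ y : Eu d) (s : ℝ) :
    exitTime (lineSection Ω θ y) 1 s = exitTime Ω θ (s • θ + y) := by
  simp only [exitTime, add_smul_mem_lineSection_iff, one_smul]

theorem Phi_smul_add (Ω : Set (Eu d)) (θ y : Eu d) (s : ℝ) :
    Phi Ω θ (s • θ + y) = (s + exitTime (lineSection Ω θ y) 1 s) • θ + y := by
  rw [exitTime_lineSection, add_smul, add_right_comm]
  rfl

theorem endVal_lineSection (Ω : Set (Eu d)) (θ y : Eu d) (u w : Eu d → ℝ) (s : ℝ) :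
    endVal (lineSection Ω θ y) 1 (fun t => u (t • θ + y)) (fun t => w (t • θ + y)) s =
      endVal Ω θ u w (s • θ + y) := by
  simp only [endVal, exitTime_lineSection, smul_eq_mul, mul_one, add_smul, add_right_comm]

theorem IsRegularAt.lineSection {s : ℝ} (h : IsRegularAt Ω θ u w (s • θ + y)) :
    IsRegularAt (lineSection Ω θ y) 1 (fun t => u (t • θ + y)) (fun t => w (t • θ + y)) s := by
  constructor
  · simpa only [chord_lineSection, smul_eq_mul, mul_one, add_smul, add_right_comm]
      using h.integrableOn
  · simpa only [chord_lineSection, smul_eq_mul, mul_one, add_smul, add_right_comm] using h.ae_eq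

theorem isBounded_lineSection (hb : Bornology.IsBounded Ω) (hθ : θ ≠ 0) (y : Eu d) :
    Bornology.IsBounded (lineSection Ω θ y) := by
  simpa only [lineSection, add_comm y] using isBounded_setOf_add_smul_mem hb hθ y

end LineSection

section DirTrace

variable {d : ℕ} {Ω : Set (Eu d)} {θ : Eu d} {u w g : Eu d → ℝ}

theorem measurable_Phi (hΩ : IsOpen Ω) (hb : Bornology.IsBounded Ω) (hθ : θ ≠ 0) :
    Measurable (Phi Ω θ) :=
  measurable_id.add ((measurable_exitTime hΩ hb hθ).smul_const θ)

theorem IsDirTrace.comp_Phi_ae_eq (h : IsDirTrace Ω θ u g) (hΩ : IsOpen Ω)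
    (hb : Bornology.IsBounded Ω) (hθ : ‖θ‖ = 1)
    (hreg : ∀ᵐ x ∂volume.restrict Ω, IsRegularAt Ω θ u w x) :
    g ∘ Phi Ω θ =ᵐ[volume.restrict Ω] endVal Ω θ u w := by
  obtain ⟨v, hv, A, -, hAn, hvA⟩ := h
  have hθ0 : θ ≠ 0 := norm_ne_zero_iff.1 (hθ ▸ one_ne_zero)
  have hvline := ae_ae_smul_add hθ ((ae_restrict_iff' hΩ.measurableSet).1 hv)
  have hproj := (quasiMeasurePreserving_orthogonalProjectionOnto θ).ae
    (hvline.and (measure_eq_zero_iff_ae_notMem.1 hAn))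
  filter_upwards [hreg, ae_restrict_of_ae hproj, ae_restrict_mem hΩ.measurableSet]
    with x hx ⟨hvx, hxA⟩ hxΩ
  set y := (Hyp θ).orthogonalProjectionOnto x
  obtain ⟨s, hs⟩ : ∃ s : ℝ, s • θ + (y : Eu d) = x :=
    ⟨_, inner_smul_add_orthogonalProjectionOnto hθ x⟩
  have hyA : y ∈ A := not_not.1 fun hn => hxA ⟨mem_image_of_mem _ hxΩ, hn⟩
  rw [← hs] at hx hxΩ
  have hJ := isOpen_lineSection hΩ θ y
  have hJb := isBounded_lineSection hb hθ0 (y : Eu d)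
  have hcomp := isComponentInterval_exitTime hJ hJb hxΩ
  have hmem : s ∈ Ioo _ _ := ⟨sub_lt_self s (exitTime_pos hJ hJb (neg_ne_zero.2 one_ne_zero) hxΩ),
    lt_add_of_pos_right s (exitTime_pos hJ hJb one_ne_zero hxΩ)⟩
  obtain ⟨f, hf, hfv, hgf⟩ := (hvA y hyA).2 _ _ hcomp
  have hvu : (fun t : ℝ => v (t • θ + y)) =ᵐ[volume.restrict (Ioo _ _)] fun t => u (t • θ + y) :=
    ae_restrict_of_ae_restrict_of_subset hcomp.2.1
      ((ae_restrict_iff' hJ.measurableSet).2 hvx)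
  rw [← hs, Function.comp_apply, Phi_smul_add, ← endVal_lineSection]
  exact (hx.lineSection.eq_endVal_iff hcomp hJ hJb hmem).2 ⟨f, hf, hfv.trans hvu, hgf⟩

theorem isDirTrace_of_comp_Phi_ae_eq (hΩ : IsOpen Ω) (hb : Bornology.IsBounded Ω)
    (hθ : ‖θ‖ = 1) (hum : StronglyMeasurable u) (hwm : StronglyMeasurable w)
    (hu : MemLp u 2 (volume.restrict Ω)) (hw : MemLp w 2 (volume.restrict Ω))
    (hreg : ∀ᵐ x ∂volume.restrict Ω, IsRegularAt Ω θ u w x)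
    (hg : g ∘ Phi Ω θ =ᵐ[volume.restrict Ω] endVal Ω θ u w) :
    IsDirTrace Ω θ u g := by
  have hθ0 : θ ≠ 0 := norm_ne_zero_iff.1 (hθ ▸ one_ne_zero)
  have hgood := ae_ae_smul_add hθ ((ae_restrict_iff' hΩ.measurableSet).1 (hreg.and hg))
  obtain ⟨A, hA, hAy⟩ := eventually_iff_exists_mem.1 <|
    (ae_memLp_lineSection hΩ hθ hum hu).and ((ae_memLp_lineSection hΩ hθ hwm hw).and hgood)
  refine ⟨u, ae_eq_refl _, projSet Ω θ ∩ A, inter_subset_left, ?_, fun y hy => ?_⟩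
  · exact measure_mono_null (fun y hy hyA => hy.2 ⟨hy.1, hyA⟩) hA
  obtain ⟨huy, hwy, hline⟩ := hAy y hy.2
  have hJ := isOpen_lineSection hΩ θ y
  have hJb := isBounded_lineSection hb hθ0 (y : Eu d)
  refine ⟨⟨huy, fun s => w (s • θ + y), hwy, ?_⟩, fun α β hαβ => ?_⟩
  · refine hasWeakDirDeriv_of_ae_isRegularAt hJ hJb one_ne_zero huy hwy ?_
    rw [ae_restrict_iff' hJ.measurableSet]
    filter_upwards [hline] with s hs hmem using (hs hmem).1.lineSection
  · obtain ⟨s, hs, hsI⟩ : ∃ s, (s • θ + (y : Eu d) ∈ Ω → IsRegularAt Ω θ u w (s • θ + y) ∧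
        (g ∘ Phi Ω θ) (s • θ + y) = endVal Ω θ u w (s • θ + y)) ∧ s ∈ Ioo α β := by
      have : NeBot (ae (volume.restrict (Ioo α β))) :=
        ae_neBot.2 (by simpa [Measure.restrict_eq_zero] using hαβ.1)
      exact ((ae_restrict_of_ae hline).and (ae_restrict_mem measurableSet_Ioo)).exists
    obtain ⟨hx, hgx⟩ := hs (hαβ.2.1 hsI)
    rw [Function.comp_apply, Phi_smul_add, hαβ.exitTime_one hsI, add_sub_cancel,
      ← endVal_lineSection] at hgx
    exact (hx.lineSection.eq_endVal_iff hαβ hJ hJb hsI).1 hgx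

end DirTrace

/-! ### Completeness of `𝓛²` of a family of measures -/

section FamilyL2

variable {X ι : Type*} [MeasurableSpace X] {m : ι → Measure X}

/-- The class in `L²(X, m_i)` of an element of `𝓛²(X, (m_i)_i)`. -/
def CalL2.toLp (i : ι) (f : CalL2 m) : Lp ℝ 2 (m i) := (f.memLp i).toLp f.toFun

theorem CalL2.edist_toLp (i : ι) (f g : CalL2 m) :
    edist (f.toLp i) (g.toLp i) = eLpNorm (f.toFun - g.toFun) 2 (m i) :=
  Lp.edist_toLp_toLp _ _ _ _

theorem CalL2.edist_le_iff {f g : CalL2 m} {C : ℝ≥0∞} :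
    edist f g ≤ C ↔ ∀ i, edist (f.toLp i) (g.toLp i) ≤ C := by
  rw [edist_dist f g, dist_eq_norm]
  simp only [CalL2.edist_toLp]
  constructor
  · refine fun h i => le_trans ?_ h
    exact (ENNReal.le_ofReal_iff_toReal_le ((f - g).memLp i).2.ne (norm_nonneg _)).2
      (le_ciSup (f - g).bddAbove i)
  · intro h
    rcases eq_or_ne C ⊤ with rfl | hC
    · exact le_top
    · exact ENNReal.ofReal_le_of_le_toReal
        (Real.iSup_le (fun i => ENNReal.toReal_mono hC (h i)) ENNReal.toReal_nonneg)

theorem CalL2.continuous_toLp (i : ι) : Continuous (CalL2.toLp i : CalL2 m → Lp ℝ 2 (m i)) :=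
  LipschitzWith.continuous (K := 1) fun f g => by
    simpa only [ENNReal.coe_one, one_mul] using CalL2.edist_le_iff.1 (le_refl (edist f g)) i

theorem mem_calL2_of_eLpNorm_le {f : X → ℝ} {C : ℝ≥0∞} (hC : C ≠ ⊤)
    (hf : ∀ i, AEStronglyMeasurable f (m i)) (hfC : ∀ i, eLpNorm f 2 (m i) ≤ C) : f ∈ calL2 m :=
  ⟨C.toReal, fun i => ⟨⟨hf i, (hfC i).trans_lt hC.lt_top⟩, ENNReal.toReal_mono hC (hfC i)⟩⟩

theorem CalL2.exists_edist_le_of_tendsto {f : ℕ → CalL2 m} {g : X → ℝ} {B : ℕ → ℝ≥0∞}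
    (hB : ∀ n, B n ≠ ⊤) (hf : ∀ N n, N ≤ n → edist (f N) (f n) ≤ B N)
    (hg : ∀ i, ∀ᵐ x ∂m i, Tendsto (fun n => (f n).toFun x) atTop (𝓝 (g x))) :
    ∃ G : CalL2 m, ∀ N, edist (f N) G ≤ B N := by
  have hgm (i : ι) : AEStronglyMeasurable g (m i) :=
    aestronglyMeasurable_of_tendsto_ae atTop (fun n => ((f n).memLp i).1) (hg i)
  have hle (N : ℕ) (i : ι) : eLpNorm ((f N).toFun - g) 2 (m i) ≤ B N := by
    have hfatou := Lp.eLpNorm_lim_le_liminf_eLpNorm (p := 2) (μ := m i)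
      (fun n => ((f N).memLp i).1.sub ((f n).memLp i).1) ((f N).toFun - g)
      ((hg i).mono fun x hx => tendsto_const_nhds.sub hx)
    refine hfatou.trans (liminf_le_of_le (by isBoundedDefault) fun b hb => ?_)
    obtain ⟨n, hbn, hNn⟩ := (hb.and (eventually_ge_atTop N)).exists
    rw [← CalL2.edist_toLp] at hbn
    exact hbn.trans (CalL2.edist_le_iff.1 (hf N n hNn) i)
  have hmem : g ∈ calL2 m := by
    have hsub := mem_calL2_of_eLpNorm_le (hB 0) (fun i => ((f 0).memLp i).1.sub (hgm i)) (hle 0)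
    rw [← sub_sub_cancel (f 0).toFun g]
    exact Submodule.sub_mem _ (Subtype.property (f 0)) hsub
  let G : CalL2 m := ⟨g, hmem⟩
  refine ⟨G, fun N => CalL2.edist_le_iff.2 fun i => ?_⟩
  rw [CalL2.edist_toLp]
  exact hle N i

/-- The pointwise limit of a rapidly Cauchy sequence exists `m i`-almost everywhere for every `i`,
so that a single function represents the limit for all the measures at once. -/
instance : CompleteSpace (CalL2 m) := by
  let B (n : ℕ) : ℝ≥0∞ := 2⁻¹ ^ n
  have hB : ∑' n, B n ≠ ⊤ := by simp [B, ENNReal.tsum_geometric]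
  have hB0 (n : ℕ) : 0 < B n := ENNReal.pow_pos (by simp) n
  refine EMetric.complete_of_convergent_controlled_sequences B hB0 fun f hf => ?_
  have hlim (i : ι) : ∀ᵐ x ∂m i,
      Tendsto (fun n => (f n).toFun x) atTop (𝓝 (limUnder atTop fun n => (f n).toFun x)) := by
    refine (Lp.ae_tendsto_of_cauchy_eLpNorm (fun n => ((f n).memLp i).1) one_le_two hB
      fun N n k hn hk => ?_).mono fun x hx => tendsto_nhds_limUnder hx
    rw [← CalL2.edist_toLp]
    exact (CalL2.edist_le_iff.1 le_rfl i).trans_lt (hf N n k hn hk)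
  obtain ⟨G, hG⟩ := CalL2.exists_edist_le_of_tendsto (fun n => ENNReal.ne_top_of_tsum_ne_top hB n)
    (fun N n hn => (hf N N n le_rfl hn).le) hlim
  exact ⟨G, tendsto_iff_edist_tendsto_0.2 (tendsto_of_tendsto_of_tendsto_of_le_of_le
    tendsto_const_nhds (ENNReal.tendsto_atTop_zero_of_tsum_ne_top hB) (fun _ => zero_le) hG)⟩

end FamilyL2

/-! ### The Sobolev space `H¹(Ω)` -/

section Sobolev

variable {d : ℕ} {Ω : Set (Eu d)} {φ : Eu d → ℝ} {θ : Eu d}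

theorem IsTestFunction.memLp_smul_const (hφ : IsTestFunction Ω φ) (θ : Eu d) :
    MemLp (fun x => φ x • θ) 2 (volume.restrict Ω) :=
  ((hφ.1.continuous.smul continuous_const).memLp_of_hasCompactSupport hφ.2.1.smul_right).restrict Ω

theorem IsTestFunction.integral_mul_fderiv_eq_inner (hφ : IsTestFunction Ω φ) (θ : Eu d)
    (u : Lp ℝ 2 (volume.restrict Ω)) :
    ∫ x in Ω, u x * fderiv ℝ φ x θ = inner ℝ ((hφ.memLp_fderiv θ).toLp _) u := by
  rw [L2.inner_def]
  refine integral_congr_ae ?_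
  filter_upwards [(hφ.memLp_fderiv θ).coeFn_toLp] with x hx
  simp [hx]

theorem IsTestFunction.integral_inner_mul_eq_inner (hφ : IsTestFunction Ω φ) (θ : Eu d)
    (w : Lp (Eu d) 2 (volume.restrict Ω)) :
    ∫ x in Ω, inner ℝ θ (w x) * φ x = inner ℝ ((hφ.memLp_smul_const θ).toLp _) w := by
  rw [L2.inner_def]
  refine integral_congr_ae ?_
  filter_upwards [(hφ.memLp_smul_const θ).coeFn_toLp] with x hx
  simp [hx, inner_smul_left, mul_comm]

theorem isClosed_H1 (Ω : Set (Eu d)) : IsClosed (H1 Ω : Set (L2Pair Ω)) := by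
  have hset : (H1 Ω : Set (L2Pair Ω)) = ⋂ (θ : Eu d) (φ : Eu d → ℝ) (hφ : IsTestFunction Ω φ),
      {p : L2Pair Ω | (inner ℝ ((hφ.memLp_fderiv θ).toLp _) p.fst : ℝ) =
        -inner ℝ ((hφ.memLp_smul_const θ).toLp _) p.snd} := by
    ext p
    simp only [mem_iInter, mem_ofPred_eq]
    refine forall_congr' fun θ => forall₂_congr fun φ hφ => ?_
    rw [hφ.integral_mul_fderiv_eq_inner, hφ.integral_inner_mul_eq_inner]
  have hfst : Continuous fun p : L2Pair Ω => p.fst := (WithLp.prod_continuous_ofLp 2 _ _).fst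
  have hsnd : Continuous fun p : L2Pair Ω => p.snd := (WithLp.prod_continuous_ofLp 2 _ _).snd
  rw [hset]
  exact isClosed_iInter fun θ => isClosed_iInter fun φ => isClosed_iInter fun hφ =>
    isClosed_eq (continuous_const.inner hfst) (continuous_const.inner hsnd).neg

instance : CompleteSpace (H1 Ω) := (isClosed_H1 Ω).completeSpace_coe

theorem stronglyMeasurable_H1val (u : H1 Ω) : StronglyMeasurable (H1val u) :=
  Lp.stronglyMeasurable _

theorem memLp_H1val (u : H1 Ω) : MemLp (H1val u) 2 (volume.restrict Ω) := Lp.memLp _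

theorem stronglyMeasurable_H1dirDeriv (u : H1 Ω) (θ : Eu d) :
    StronglyMeasurable (H1dirDeriv u θ) :=
  stronglyMeasurable_const.inner (Lp.stronglyMeasurable _)

theorem memLp_H1dirDeriv (u : H1 Ω) (θ : Eu d) :
    MemLp (H1dirDeriv u θ) 2 (volume.restrict Ω) := (Lp.memLp _).const_inner θ

theorem H1dirDeriv_neg (u : H1 Ω) (θ : Eu d) : H1dirDeriv u (-θ) = -H1dirDeriv u θ :=
  funext fun _ => inner_neg_left _ _

theorem integrableOn_of_memLp_two (hb : Bornology.IsBounded Ω) {f : Eu d → ℝ}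
    (hf : MemLp f 2 (volume.restrict Ω)) : IntegrableOn f Ω := by
  have : IsFiniteMeasure (volume.restrict Ω) := ⟨by simpa using hb.measure_lt_top⟩
  exact hf.integrable one_le_two

theorem ae_isRegularAt_H1 (hΩ : IsOpen Ω) (hb : Bornology.IsBounded Ω) (hθ : θ ≠ 0) (u : H1 Ω) :
    ∀ᵐ x ∂volume.restrict Ω, IsRegularAt Ω θ (H1val u) (H1dirDeriv u θ) x :=
  HasWeakDirDeriv.ae_isRegularAt (u.2 θ) hΩ hb hθ (stronglyMeasurable_H1val u)
    (stronglyMeasurable_H1dirDeriv u θ) (integrableOn_of_memLp_two hb (memLp_H1val u))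
    (integrableOn_of_memLp_two hb (memLp_H1dirDeriv u θ))

theorem eLpNorm_H1val_sub_le (u v : H1 Ω) :
    eLpNorm (H1val u - H1val v) 2 (volume.restrict Ω) ≤ edist u v := by
  have hsub : H1val u - H1val v =ᵐ[volume.restrict Ω]
      ((u : L2Pair Ω).fst - (v : L2Pair Ω).fst : Lp ℝ 2 (volume.restrict Ω)) :=
    (Lp.coeFn_sub _ _).symm
  rw [eLpNorm_congr_ae hsub, ← Lp.enorm_def, edist_eq_enorm_sub]
  exact enorm_le_iff_norm_le.2 (WithLp.norm_fst_le _ ((u - v : H1 Ω) : L2Pair Ω))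

theorem eLpNorm_H1dirDeriv_sub_le (hθ : ‖θ‖ = 1) (u v : H1 Ω) :
    eLpNorm (H1dirDeriv u θ - H1dirDeriv v θ) 2 (volume.restrict Ω) ≤ edist u v := by
  have hle : ∀ᵐ x ∂volume.restrict Ω, ‖(H1dirDeriv u θ - H1dirDeriv v θ) x‖ ≤
      ‖((u : L2Pair Ω).snd - (v : L2Pair Ω).snd) x‖ := by
    filter_upwards [Lp.coeFn_sub (u : L2Pair Ω).snd (v : L2Pair Ω).snd] with x hx
    rw [hx, Pi.sub_apply, H1dirDeriv, H1dirDeriv, ← inner_sub_right]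
    simpa [hθ] using norm_inner_le_norm (𝕜 := ℝ) θ ((u : L2Pair Ω).snd x - (v : L2Pair Ω).snd x)
  refine (eLpNorm_mono_ae hle).trans ?_
  rw [← Lp.enorm_def, edist_eq_enorm_sub]
  exact enorm_le_iff_norm_le.2 (WithLp.norm_snd_le _ ((u - v : H1 Ω) : L2Pair Ω))

end Sobolev

/-! ### The trace estimate -/

section Trace

variable {d : ℕ} {Ω : Set (Eu d)} {θ : Eu d}

theorem ne_zero_of_mem_sph (θ : Sph d) : (θ : Eu d) ≠ 0 := ne_zero_of_mem_unit_sphere θ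

theorem eLpNorm_endVal_sub_le (hΩ : IsOpen Ω) (hb : Bornology.IsBounded Ω) (hθ : ‖θ‖ = 1)
    (u v : H1 Ω) :
    eLpNorm (endVal Ω θ (H1val u) (H1dirDeriv u θ) - endVal Ω θ (H1val v) (H1dirDeriv v θ)) 2
      (volume.restrict Ω) ≤ (1 + Metric.ediam Ω) * edist u v := by
  have hθ0 : θ ≠ 0 := norm_ne_zero_iff.1 (hθ ▸ one_ne_zero)
  calc _ = eLpNorm (endVal Ω θ (H1val u - H1val v) (H1dirDeriv u θ - H1dirDeriv v θ)) 2
        (volume.restrict Ω) := (eLpNorm_congr_ae (endVal_sub_ae_eq hΩ hb hθ0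
          (integrableOn_of_memLp_two hb (memLp_H1dirDeriv u θ))
          (integrableOn_of_memLp_two hb (memLp_H1dirDeriv v θ)))).symm
    _ ≤ eLpNorm (H1val u - H1val v) 2 (volume.restrict Ω) +
        Metric.ediam Ω * eLpNorm (H1dirDeriv u θ - H1dirDeriv v θ) 2 (volume.restrict Ω) :=
      eLpNorm_endVal_le hΩ hb hθ one_le_two ENNReal.ofNat_ne_top
        ((stronglyMeasurable_H1val u).sub (stronglyMeasurable_H1val v))
        ((stronglyMeasurable_H1dirDeriv u θ).sub (stronglyMeasurable_H1dirDeriv v θ))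
    _ ≤ edist u v + Metric.ediam Ω * edist u v := by
      gcongr
      · exact eLpNorm_H1val_sub_le u v
      · exact eLpNorm_H1dirDeriv_sub_le hθ u v
    _ = (1 + Metric.ediam Ω) * edist u v := by rw [add_mul, one_mul]

theorem memLp_endVal (hΩ : IsOpen Ω) (hb : Bornology.IsBounded Ω) (hθ : ‖θ‖ = 1) (u : H1 Ω) :
    MemLp (endVal Ω θ (H1val u) (H1dirDeriv u θ)) 2 (volume.restrict Ω) :=
  have hu := stronglyMeasurable_H1val u
  have hw := stronglyMeasurable_H1dirDeriv u θ
  ⟨(stronglyMeasurable_endVal hΩ hb (norm_ne_zero_iff.1 (hθ ▸ one_ne_zero)) hu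
    hw).aestronglyMeasurable,
    (eLpNorm_endVal_le hΩ hb hθ one_le_two ENNReal.ofNat_ne_top hu hw).trans_lt <|
      ENNReal.add_lt_top.2 ⟨(memLp_H1val u).2,
        ENNReal.mul_lt_top hb.ediam_ne_top.lt_top (memLp_H1dirDeriv u θ).2⟩⟩

/-- The boundary values `x ↦ tr u (Φ_θ(x))` of `u ∈ H¹(Ω)` along the chords parallel to `θ`, as an
element of `L²(Ω)`. They exist for every `u`; what may fail is that, as `θ` varies, they are read
off one function on `∂Ω`. -/
def exitVal (hΩ : IsOpen Ω) (hb : Bornology.IsBounded Ω) (θ : Sph d) (u : H1 Ω) :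
    Lp ℝ 2 (volume.restrict Ω) :=
  (memLp_endVal hΩ hb (norm_eq_of_mem_sphere θ) u).toLp _

theorem lipschitzWith_exitVal (hΩ : IsOpen Ω) (hb : Bornology.IsBounded Ω) (θ : Sph d) :
    LipschitzWith (1 + (Metric.ediam Ω).toNNReal) (exitVal hΩ hb θ) := fun u v => by
  rw [exitVal, exitVal, Lp.edist_toLp_toLp, ENNReal.coe_add, ENNReal.coe_toNNReal hb.ediam_ne_top]
  exact eLpNorm_endVal_sub_le hΩ hb (norm_eq_of_mem_sphere θ) u v

theorem measurePreserving_Phi (hΩ : IsOpen Ω) (hb : Bornology.IsBounded Ω) (θ : Sph d) :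
    MeasurePreserving (Phi Ω θ) (volume.restrict Ω) (dirMeasures Ω θ) :=
  (measurable_Phi hΩ hb (ne_zero_of_mem_sph θ)).measurePreserving _

theorem IsOmniTrace.comp_Phi_ae_eq {u : H1 Ω} {g : Eu d → ℝ} (h : IsOmniTrace Ω u g)
    (hΩ : IsOpen Ω) (hb : Bornology.IsBounded Ω) (θ : Sph d) :
    g ∘ Phi Ω θ =ᵐ[volume.restrict Ω] endVal Ω θ (H1val u) (H1dirDeriv u θ) := by
  obtain ⟨k, hk, hkg⟩ := h.2 θ
  exact (ae_eq_comp (measurePreserving_Phi hΩ hb θ).measurable.aemeasurable hkg).symm.trans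
    (hk.comp_Phi_ae_eq hΩ hb (norm_eq_of_mem_sphere θ)
      (ae_isRegularAt_H1 hΩ hb (ne_zero_of_mem_sph θ) u))

theorem isOmniTrace_iff_exitVal_eq (hΩ : IsOpen Ω) (hb : Bornology.IsBounded Ω) {u : H1 Ω}
    {g : CalL2 (dirMeasures Ω)} :
    IsOmniTrace Ω u g.toFun ↔ ∀ θ : Sph d, exitVal hΩ hb θ u =
      Lp.compMeasurePreserving (Phi Ω θ) (measurePreserving_Phi hΩ hb θ) (g.toLp θ) := by
  simp only [exitVal, CalL2.toLp, Lp.toLp_compMeasurePreserving, MemLp.toLp_eq_toLp_iff]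
  refine ⟨fun h θ => (h.comp_Phi_ae_eq hΩ hb θ).symm, fun h => ⟨g.property, fun θ => ?_⟩⟩
  exact ⟨g.toFun, isDirTrace_of_comp_Phi_ae_eq hΩ hb (norm_eq_of_mem_sphere θ)
    (stronglyMeasurable_H1val u) (stronglyMeasurable_H1dirDeriv u θ) (memLp_H1val u)
    (memLp_H1dirDeriv u θ) (ae_isRegularAt_H1 hΩ hb (ne_zero_of_mem_sph θ) u) (h θ).symm,
    ae_eq_refl _⟩

theorem IsOmniTrace.edist_le {u v : H1 Ω} {g h : CalL2 (dirMeasures Ω)}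
    (hg : IsOmniTrace Ω u g.toFun) (hh : IsOmniTrace Ω v h.toFun) (hΩ : IsOpen Ω)
    (hb : Bornology.IsBounded Ω) :
    edist g h ≤ (1 + (Metric.ediam Ω).toNNReal : NNReal) * edist u v := by
  refine CalL2.edist_le_iff.2 fun θ => ?_
  rw [← Lp.isometry_compMeasurePreserving (measurePreserving_Phi hΩ hb θ),
    ← (isOmniTrace_iff_exitVal_eq hΩ hb).1 hg, ← (isOmniTrace_iff_exitVal_eq hΩ hb).1 hh]
  exact lipschitzWith_exitVal hΩ hb θ u v

/-! ### The trace operator -/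

/-- The graph of the trace operator, with traces represented by functions. -/
def traceGraph (Ω : Set (Eu d)) : Set (H1 Ω × CalL2 (dirMeasures Ω)) :=
  {p | IsOmniTrace Ω p.1 p.2.toFun}

theorem isClosed_traceGraph (hΩ : IsOpen Ω) (hb : Bornology.IsBounded Ω) :
    IsClosed (traceGraph Ω) := by
  simp only [traceGraph, isOmniTrace_iff_exitVal_eq hΩ hb, ofPred_forall]
  exact isClosed_iInter fun θ => isClosed_eq
    ((lipschitzWith_exitVal hΩ hb θ).continuous.comp continuous_fst)
    ((Lp.isometry_compMeasurePreserving (measurePreserving_Phi hΩ hb θ)).continuous.comp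
      ((CalL2.continuous_toLp θ).comp continuous_snd))

theorem antilipschitzWith_fst_traceGraph (hΩ : IsOpen Ω) (hb : Bornology.IsBounded Ω) :
    AntilipschitzWith (1 + (Metric.ediam Ω).toNNReal) fun p : traceGraph Ω => p.1.1 := fun p q =>
  max_le (le_mul_of_one_le_left' (by simp)) (p.2.edist_le q.2 hΩ hb)

theorem isClosed_H1tr (hΩ : IsOpen Ω) (hb : Bornology.IsBounded Ω) :
    IsClosed (H1tr Ω : Set (H1 Ω)) := by
  have hrange : (H1tr Ω : Set (H1 Ω)) = range fun p : traceGraph Ω => p.1.1 := by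
    ext u
    exact ⟨fun ⟨g, hg⟩ => ⟨⟨(u, ⟨g, hg.1⟩), hg⟩, rfl⟩, fun ⟨p, hp⟩ => ⟨p.1.2.toFun, hp ▸ p.2⟩⟩
  have := (isClosed_traceGraph hΩ hb).completeSpace_coe
  rw [hrange]
  exact (antilipschitzWith_fst_traceGraph hΩ hb).isClosed_range
    (uniformContinuous_fst.comp uniformContinuous_subtype_val)

theorem isOmniTrace_iff_mk_eq_tr (hΩ : IsOpen Ω) (hb : Bornology.IsBounded Ω) (u : H1tr Ω)
    (g : Eu d → ℝ) (hg : g ∈ calL2 (dirMeasures Ω)) :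
    IsOmniTrace Ω (u : H1 Ω) g ↔ L2Family.mk g hg = tr Ω u := by
  have htr := u.2.choose_spec
  constructor
  · intro h
    have hle := IsOmniTrace.edist_le (g := ⟨g, hg⟩) (h := ⟨_, htr.1⟩) h htr hΩ hb
    rw [edist_self, mul_zero, nonpos_iff_eq_zero] at hle
    exact SeparationQuotient.mk_eq_mk.2 (EMetric.inseparable_iff.2 hle)
  · intro h
    refine ⟨hg, fun θ => ?_⟩
    obtain ⟨k, hk, hk'⟩ := htr.2 θ
    exact ⟨k, hk, hk'.trans ((L2Family.mk_eq_mk_iff _ _ _ _).1 h θ).symm⟩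

theorem isLinearMap_tr (hΩ : IsOpen Ω) (hb : Bornology.IsBounded Ω) : IsLinearMap ℝ (tr Ω) := by
  have key (a b : ℝ) (u v : H1tr Ω) : tr Ω (a • u + b • v) = a • tr Ω u + b • tr Ω v := by
    have hu := u.2.choose_spec
    have hv := v.2.choose_spec
    have hval : H1val ((a • u + b • v : H1tr Ω) : H1 Ω) =ᵐ[volume.restrict Ω]
        fun x => a * H1val (u : H1 Ω) x + b * H1val (v : H1 Ω) x := by
      filter_upwards [Lp.coeFn_add (a • ((u : H1 Ω) : L2Pair Ω).fst)
          (b • ((v : H1 Ω) : L2Pair Ω).fst), Lp.coeFn_smul a ((u : H1 Ω) : L2Pair Ω).fst,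
        Lp.coeFn_smul b ((v : H1 Ω) : L2Pair Ω).fst] with x hadd hua hvb
      exact hadd.trans (congrArg₂ (· + ·) hua hvb)
    have h := hu.lincomb hv hval
    exact ((isOmniTrace_iff_mk_eq_tr hΩ hb _ _ h.1).1 h).symm
  exact ⟨fun u v => by simpa using key 1 1 u v, fun c u => by simpa using key c 0 u u⟩

theorem lipschitzWith_tr (hΩ : IsOpen Ω) (hb : Bornology.IsBounded Ω) :
    LipschitzWith (1 + (Metric.ediam Ω).toNNReal) (tr Ω) := fun u v => by
  let rep (w : H1tr Ω) : CalL2 (dirMeasures Ω) := ⟨w.2.choose, w.2.choose_spec.1⟩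
  have hrep (w : H1tr Ω) : IsOmniTrace Ω (w : H1 Ω) (rep w).toFun := w.2.choose_spec
  calc edist (tr Ω u) (tr Ω v) = edist (rep u) (rep v) := SeparationQuotient.edist_mk _ _
    _ ≤ (1 + (Metric.ediam Ω).toNNReal : NNReal) * edist (u : H1 Ω) v :=
      (hrep u).edist_le (hrep v) hΩ hb

end Trace

/-! ### Integration by parts -/

section IntegrationByParts

variable {d : ℕ} {Ω : Set (Eu d)}

theorem chordDist_neg_Phi {θ x : Eu d} (hΩ : IsOpen Ω) (hb : Bornology.IsBounded Ω) (hθ : θ ≠ 0)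
    (hx : x ∈ Ω) : chordDist Ω (-θ) (Phi Ω θ x) = exitTime Ω θ x + exitTime Ω (-θ) x := by
  have hpos := exitTime_pos hΩ hb hθ hx
  have hneg := exitTime_pos hΩ hb (neg_ne_zero.2 hθ) hx
  have hback (t : ℝ) : Phi Ω θ x + t • -θ = x + (exitTime Ω θ x - t) • θ := by
    change x + exitTime Ω θ x • θ + t • -θ = _
    module
  refine exitTime_eq (add_pos hpos hneg) (fun t ht => ?_) ?_
  · rw [hback]
    refine add_smul_mem_of_mem_chord ?_
    rw [chord_eq_Ioo hΩ hb hθ hx]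
    constructor <;> linarith [ht.1, ht.2]
  · rw [hback, sub_add_cancel_left, neg_smul, ← smul_neg]
    exact add_exitTime_smul_notMem hΩ hb (neg_ne_zero.2 hθ) hx

theorem Phi_neg_Phi {θ x : Eu d} (hΩ : IsOpen Ω) (hb : Bornology.IsBounded Ω) (hθ : θ ≠ 0)
    (hx : x ∈ Ω) : Phi Ω (-θ) (Phi Ω θ x) = Phi Ω (-θ) x := by
  rw [Phi, chordDist_neg_Phi hΩ hb hθ hx]
  change x + exitTime Ω θ x • θ + _ = x + exitTime Ω (-θ) x • -θ
  module

theorem chordLen_Phi {θ x : Eu d} (hΩ : IsOpen Ω) (hb : Bornology.IsBounded Ω) (hθ : ‖θ‖ = 1)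
    (hx : x ∈ Ω) : chordLen Ω θ (Phi Ω θ x) = (volume (chord Ω θ x)).toReal := by
  have hθ0 : θ ≠ 0 := norm_ne_zero_iff.1 (hθ ▸ one_ne_zero)
  have hpos : 0 ≤ exitTime Ω θ x + exitTime Ω (-θ) x :=
    (add_pos (exitTime_pos hΩ hb hθ0 hx) (exitTime_pos hΩ hb (neg_ne_zero.2 hθ0) hx)).le
  rw [chordLen, Phi, chordDist_neg_Phi hΩ hb hθ0 hx, add_sub_cancel_left, norm_smul, norm_neg, hθ,
    mul_one, Real.norm_of_nonneg hpos, volume_chord hΩ hb hθ0 hx, ENNReal.toReal_ofReal hpos]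

theorem measurable_chordLen {θ : Eu d} (hΩ : IsOpen Ω) (hb : Bornology.IsBounded Ω) (hθ : θ ≠ 0) :
    Measurable (chordLen Ω θ) :=
  ((measurable_Phi hΩ hb (neg_ne_zero.2 hθ)).sub measurable_id).norm

theorem measurePreserving_Phi_neg (hΩ : IsOpen Ω) (hb : Bornology.IsBounded Ω) (θ : Sph d) :
    MeasurePreserving (Phi Ω (-θ)) (dirMeasure Ω θ) (dirMeasure Ω (-θ)) := by
  have hθ := ne_zero_of_mem_sph θ
  have hm := measurable_Phi hΩ hb (neg_ne_zero.2 hθ)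
  refine ⟨hm, ?_⟩
  rw [dirMeasure, dirMeasure, Measure.map_map hm (measurable_Phi hΩ hb hθ)]
  refine Measure.map_congr ?_
  filter_upwards [ae_restrict_mem hΩ.measurableSet] with x hx
  exact Phi_neg_Phi hΩ hb hθ hx

variable {u v : H1 Ω} {g h : Eu d → ℝ}

theorem IsOmniTrace.aestronglyMeasurable (hg : IsOmniTrace Ω u g) (θ : Sph d) :
    AEStronglyMeasurable g (dirMeasure Ω θ) :=
  (hg.1.choose_spec θ).1.1

theorem IsOmniTrace.aestronglyMeasurable_comp_Phi_neg (hg : IsOmniTrace Ω u g) (hΩ : IsOpen Ω)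
    (hb : Bornology.IsBounded Ω) (θ : Sph d) :
    AEStronglyMeasurable (fun z => g (Phi Ω (-θ) z)) (dirMeasure Ω θ) := by
  have hneg := hg.aestronglyMeasurable (-θ)
  rw [coe_neg_sphere] at hneg
  exact hneg.comp_measurePreserving (measurePreserving_Phi_neg hΩ hb θ)

/-- The boundary integrand of the integration by parts formula: the difference quotient of the
product of the traces `g` and `h` over the chord of direction `θ` that ends at `z`. -/
def chordQuotient (Ω : Set (Eu d)) (θ : Eu d) (g h : Eu d → ℝ) (z : Eu d) : ℝ :=
  (g z * h z - g (Phi Ω (-θ) z) * h (Phi Ω (-θ) z)) / chordLen Ω θ z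

theorem IsOmniTrace.aestronglyMeasurable_chordQuotient (hg : IsOmniTrace Ω u g)
    (hh : IsOmniTrace Ω v h) (hΩ : IsOpen Ω) (hb : Bornology.IsBounded Ω) (θ : Sph d) :
    AEStronglyMeasurable (chordQuotient Ω θ g h) (dirMeasure Ω θ) :=
  (((hg.aestronglyMeasurable θ).mul (hh.aestronglyMeasurable θ)).sub
    ((hg.aestronglyMeasurable_comp_Phi_neg hΩ hb θ).mul
      (hh.aestronglyMeasurable_comp_Phi_neg hΩ hb θ))).div₀
    (measurable_chordLen hΩ hb (ne_zero_of_mem_sph θ)).aestronglyMeasurable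

theorem IsOmniTrace.comp_Phi_neg_ae_eq (hg : IsOmniTrace Ω u g) (hΩ : IsOpen Ω)
    (hb : Bornology.IsBounded Ω) (θ : Sph d) :
    g ∘ Phi Ω (-θ) =ᵐ[volume.restrict Ω] endVal Ω (-θ) (H1val u) (-H1dirDeriv u θ) := by
  have hneg := hg.comp_Phi_ae_eq hΩ hb (-θ)
  rwa [coe_neg_sphere, H1dirDeriv_neg] at hneg

theorem IsOmniTrace.chordQuotient_comp_Phi_ae_eq (hg : IsOmniTrace Ω u g)
    (hh : IsOmniTrace Ω v h) (hΩ : IsOpen Ω) (hb : Bornology.IsBounded Ω) (θ : Sph d) :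
    chordQuotient Ω θ g h ∘ Phi Ω θ =ᵐ[volume.restrict Ω] fun x =>
      (volume (chord Ω (θ : Eu d) x)).toReal⁻¹ *
        (endVal Ω θ (H1val u) (H1dirDeriv u θ) x * endVal Ω θ (H1val v) (H1dirDeriv v θ) x -
          endVal Ω (-θ) (H1val u) (-H1dirDeriv u θ) x *
            endVal Ω (-θ) (H1val v) (-H1dirDeriv v θ) x) := by
  filter_upwards [ae_restrict_mem hΩ.measurableSet, hg.comp_Phi_ae_eq hΩ hb θ,
    hh.comp_Phi_ae_eq hΩ hb θ, hg.comp_Phi_neg_ae_eq hΩ hb θ,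
    hh.comp_Phi_neg_ae_eq hΩ hb θ] with x hx hgx hhx hgx' hhx'
  rw [← hgx, ← hhx, ← hgx', ← hhx', ← chordLen_Phi hΩ hb (norm_eq_of_mem_sphere θ) hx,
    ← div_eq_inv_mul]
  simp only [Function.comp_apply, chordQuotient, Phi_neg_Phi hΩ hb (ne_zero_of_mem_sph θ) hx]

theorem IsOmniTrace.integral_by_parts (hg : IsOmniTrace Ω u g) (hh : IsOmniTrace Ω v h)
    (hΩ : IsOpen Ω) (hb : Bornology.IsBounded Ω) (θ : Sph d) :
    Integrable (chordQuotient Ω θ g h) (dirMeasure Ω θ) ∧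
    ∫ x in Ω, (H1val u x * H1dirDeriv v θ x + H1val v x * H1dirDeriv u θ x) =
      ∫ z, chordQuotient Ω θ g h z ∂(dirMeasure Ω θ) := by
  have hθ := ne_zero_of_mem_sph θ
  have hΦ := (measurable_Phi hΩ hb hθ).aemeasurable (μ := volume.restrict Ω)
  have hmeas := hg.aestronglyMeasurable_chordQuotient hh hΩ hb θ
  have hae := hg.chordQuotient_comp_Phi_ae_eq hh hΩ hb θ
  obtain ⟨hint, heq⟩ := integral_mul_add_of_ae_isRegularAt hΩ hb hθ (ae_isRegularAt_H1 hΩ hb hθ u)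
    (ae_isRegularAt_H1 hΩ hb hθ v)
    (((memLp_H1val u).integrable_mul (memLp_H1dirDeriv v θ)).add
      ((memLp_H1val v).integrable_mul (memLp_H1dirDeriv u θ)))
  constructor
  · exact (integrable_map_measure hmeas hΦ).2 (hint.congr hae.symm)
  · rw [heq]
    exact (integral_congr_ae hae.symm).trans (integral_map hΦ hmeas).symm

end IntegrationByParts

end OmniTrace

end

theorem theorem3 (d : ℕ) (hd : 1 ≤ d) (Ω : Set (EuclideanSpace ℝ (Fin d)))
    (hΩ : IsOpen Ω) (hb : Bornology.IsBounded Ω) :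
    -- `H¹_tr(Ω)` is closed in `H¹(Ω)`, hence a Hilbert space
    IsClosed (H1tr Ω : Set (H1 Ω)) ∧ CompleteSpace (H1tr Ω) ∧
    -- the trace is well defined: its representatives are exactly the omnidirectional traces
    (∀ (u : H1tr Ω) (g : EuclideanSpace ℝ (Fin d) → ℝ) (hg : g ∈ calL2 (dirMeasures Ω)),
      IsOmniTrace Ω (u : H1 Ω) g ↔ L2Family.mk g hg = tr Ω u) ∧
    -- it is a continuous linear operator
    IsLinearMap ℝ (tr Ω) ∧ Continuous (tr Ω) ∧
    -- integration by parts, for all representatives `g`, `h` of `tr u`, `tr v`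
    (∀ (u v : H1tr Ω) (θ : Metric.sphere (0 : EuclideanSpace ℝ (Fin d)) 1)
      (g h : EuclideanSpace ℝ (Fin d) → ℝ)
      (hg : g ∈ calL2 (dirMeasures Ω)) (hh : h ∈ calL2 (dirMeasures Ω)),
      L2Family.mk g hg = tr Ω u → L2Family.mk h hh = tr Ω v →
      MeasureTheory.Integrable (fun z => (g z * h z - g (Phi Ω (-θ) z) * h (Phi Ω (-θ) z)) /
          chordLen Ω θ z) (dirMeasure Ω θ) ∧
      ∫ x in Ω, (H1val (u : H1 Ω) x * H1dirDeriv (v : H1 Ω) θ x +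
          H1val (v : H1 Ω) x * H1dirDeriv (u : H1 Ω) θ x) =
        ∫ z, (g z * h z - g (Phi Ω (-θ) z) * h (Phi Ω (-θ) z)) / chordLen Ω θ z
          ∂(dirMeasure Ω θ)) :=
  ⟨isClosed_H1tr hΩ hb, (isClosed_H1tr hΩ hb).completeSpace_coe,
    isOmniTrace_iff_mk_eq_tr hΩ hb, isLinearMap_tr hΩ hb, (lipschitzWith_tr hΩ hb).continuous,
    fun u v θ g h hg hh hgu hhv =>
      ((isOmniTrace_iff_mk_eq_tr hΩ hb u g hg).2 hgu).integral_by_parts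
        ((isOmniTrace_iff_mk_eq_tr hΩ hb v h hh).2 hhv) hΩ hb θ⟩
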